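/- Let $\Bbbk$ be an algebraically closed field of characteristic zero and let $\mathcal D$ be a veined fusion category over $\Bbbk$, that is: a $\Bbbk$-linear monoidal category with associator $a$ and a finite set $S$ of pairwise non-isomorphic simple objects such that (i) $1\in S$; (ii) $\dim\mathrm{Hom}(i,j)=\delta_{i,j}$ for $i,j\in S$; (iii) for every $i\in S$ there is a unique $\bar i\in S$ with $\dim\mathrm{Hom}(j\otimes\bar i,1)=\dim\mathrm{Hom}(\bar i\otimes j,1)=\delta_{i,j}$ for all $j\in S$; (iv) every object is a finite direct sum of tensor products of objects in $S$; (v) every object is isomorphic to a finite direct sum of objects in $S$; and such that all numbers $F_i$ defined below are invertible. Write $H_{ij}^m=\mathrm{Hom}(i\otimes j,m)$ and $H^{ij}_m=\mathrm{Hom}(m,i\otimes j)$. Fix bases of all the spaces $H_{ij}^m$ with $i,j,m\in S$, the bases of $H_{i1}^i$ and $H_{1i}^i$ being the (coherent) identity, and endow $H^{ij}_m$ with the dual bases, $\alpha'\circ\bar\alpha=\delta_{\alpha,\alpha'}\,\mathrm{id}_m$. The $6j$-symbols and inverse $6j$-symbols are defined by $$\alpha\circ(\mathrm{id}_i\otimes\beta)\circ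 a_{i,j,r}=\sum_{q,\gamma,\delta}F^{(i\,j\,r)\,l}_{\alpha p\beta,\gamma q\delta}\;\delta\circ(\gamma\otimes\mathrm{id}_r),\qquad \delta\circ(\gamma\otimes\mathrm{id}_r)\circ a_{i,j,r}^{-1}=\sum_{p,\alpha,\beta}G^{(i\,j\,r)\,l}_{\gamma q\delta,\alpha p\beta}\;\alpha\circ(\mathrm{id}_i\otimes\beta)$$ for basis elements $\alpha\in H_{ip}^l$, $\beta\in H_{jr}^p$, $\gamma\in H_{ij}^q$, $\delta\in H_{qr}^l$, and $F_i$ is the entry with $p=q=1$ of $F^{(i\,\bar i\,i)\,i}$. Let $e_i\in H_{i\bar i}^1$ be the chosen basis vector, so $\bar e_{\bar i}\in\mathrm{Hom}(1,\bar i\otimes i)$. Fix arbitrary invertible scalars $(\mu_i)_{i\in S}$ and set $$\cup_i=\mu_i\,\bar e_{\bar i}:1\to\bar i\otimes i,\qquad \cap_i=(\mu_iF_{\bar i})^{-1}e_i:i\otimes\bar i\to1 .$$ The left and right dimensions are $d_i=\dim_L(i)=\cap_i\circ\cup_{\bar i}$ and $\dim_R(i)=\cap_{\bar i}\circ\cup_i$.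 For each $i\in S$ choose a square root $\sqrt{d_id_{\bar i}}$, the same one for $i$ and $\bar i$, with the convention that $\sqrt{d_id_{\bar i}}=d_i$ if $d_i=d_{\bar i}$, and put $\sqrt{d_i/d_{\bar i}}:=d_i/\sqrt{d_id_{\bar i}}$. For $\alpha\in H_{ij}^m$ the double dual $\alpha^{\vee\vee}\in H_{ij}^m$ is obtained by applying twice the right duality defined by evaluations $\cap_{\bar i}$ and coevaluations $\cup_{\bar i}$ for $i\in S$ (nested for tensor products). The double-dual signs are the $\varepsilon_\alpha\in\{\pm1\}$ with $$\alpha^{\vee\vee}=\varepsilon_\alpha\,\sqrt{d_i/d_{\bar i}}\,\sqrt{d_j/d_{\bar j}}\,\sqrt{d_{\bar m}/d_m}\;\alpha ,\qquad 0\ne\alpha\in H_{ij}^m .$$ Define the partial duals (suppressing associators) by $L\alpha=(\mathrm{id}_{\bar i}\otimes\alpha)\circ(\cup_i\otimes\mathrm{id}_j)\in H^{\bar i m}_j$ and $R\alpha=(\alpha\otimes\mathrm{id}_{\bar j})\circ(\mathrm{id}_i\otimes\cup_{\bar j})\in H^{m\bar j}_i$ for $\alpha\in H_{ij}^m$, and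 $L\phi=(\cap_{\bar i}\otimes\mathrm{id}_j)\circ(\mathrm{id}_{\bar i}\otimes\phi)\in H_{\bar i m}^j$ and $R\phi=(\mathrm{id}_i\otimes\cap_j)\circ(\phi\otimes\mathrm{id}_{\bar j})\in H_{m\bar j}^i$ for $\phi\in H^{ij}_m$. Let $H^{(4)}$ be the direct sum over $(i,j,r,l,p,q)\in S^6$ of the spaces $$H^{(i\,j\,r)\,l}_{pq}\oplus\widetilde H^{(i\,j\,r)\,l}_{pq},\qquad H^{(i\,j\,r)\,l}_{pq}=H_{jr}^p\otimes H^{qr}_l\otimes H_{ip}^l\otimes H^{ij}_q,\qquad \widetilde H^{(i\,j\,r)\,l}_{pq}=H^{jr}_p\otimes H_{qr}^l\otimes H^{ip}_l\otimes H_{ij}^q ,$$ and let $\tau_{12},\tau_{23},\tau_{34}$ be the linear endomorphisms of $H^{(4)}$ that act on $x_1\otimes x_2\otimes x_3\otimes x_4$ in $H^{(i\,j\,r)\,l}_{pq}$, respectively in $\widetilde H^{(i\,j\,r)\,l}_{pq}$, by $$\tau_{12}:\ \mapsto x_2\otimes x_1\otimes Lx_3\otimes Lx_4,\qquad \tau_{23}:\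 \mapsto Lx_1\otimes x_3\otimes x_2\otimes Rx_4,\qquad \tau_{34}:\ \mapsto Rx_1\otimes Rx_2\otimes x_4\otimes x_3 ,$$ with values in the summand $\widetilde H$, respectively $H$, labeled by $(\bar i\,q\,r)\,p;\,l,j$, by $(q\,\bar j\,p)\,l;\,r,i$ and by $(i\,p\,\bar r)\,q;\,j,l$, respectively. Let $\mathbb F:H^{(4)}\to\Bbbk$ be the linear function given on basis elements of $H^{(i\,j\,r)\,l}_{pq}$ and $\widetilde H^{(i\,j\,r)\,l}_{pq}$ by $$\mathbb F(\beta\otimes\bar\delta\otimes\alpha\otimes\bar\gamma)=\sqrt{d_ld_{\bar l}}\;F^{(i\,j\,r)\,l}_{\alpha p\beta,\gamma q\delta},\qquad \mathbb F(\bar\beta\otimes\delta\otimes\bar\alpha\otimes\gamma)=\sqrt{d_ld_{\bar l}}\;G^{(i\,j\,r)\,l}_{\gamma q\delta,\alpha p\beta}.$$ Theorem. The maps $\tau_{12},\tau_{23},\tau_{34}$ generate an $\mathfrak S_4$-action on $H^{(4)}$ (i.e. there is a linear representation $\rho$ of $\mathfrak S_4$ on $H^{(4)}$ with $\rho((1\,2))=\tau_{12}$,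 $\rho((2\,3))=\tau_{23}$, $\rho((3\,4))=\tau_{34}$) that leaves $\mathbb F$ invariant (i.e. $\mathbb F(\rho(g)^{-1}x)=\mathbb F(x)$ for all $g\in\mathfrak S_4$ and $x\in H^{(4)}$) if and only if $\dim_L(i)=\dim_R(i)$ for all $i\in S$ and all the double-dual signs $\varepsilon_\alpha$ are equal to $1$. -/

import Mathlib

open CategoryTheory MonoidalCategory Limits TensorProduct

noncomputable section

open scoped Classical

namespace Veined

universe v u w

/-- Tensor products, with arbitrary bracketing, of finitely many objects of the set `S`. -/
inductive IsTensorProductOf {D : Type u} [Category.{v} D] [MonoidalCategory D] (S : Set D) :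
    D → Prop
  | of (x : D) : x ∈ S → IsTensorProductOf S x
  | tensor (x y : D) : IsTensorProductOf S x → IsTensorProductOf S y →
      IsTensorProductOf S (x ⊗ y)

/-- A `k`-linear monoidal category `D` together with a finite set `S` of pairwise non-isomorphic
simple objects, containing the unit, with one-dimensional or zero Hom spaces between them, with an
involution `i ↦ ī` characterized by the spaces `Hom(j ⊗ ī, 1)` and `Hom(ī ⊗ j, 1)`, and such that
every object is a finite direct sum of tensor products of objects in `S` and is isomorphic to a
finite direct sum of objects in `S`.  No rigidity is assumed. -/
structure PreFusionCategory (k : Type w) [Field k] (D : Type u) [Category.{v} D] [Preadditive D]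
    [Linear k D] [MonoidalCategory D] [MonoidalPreadditive D] [MonoidalLinear k D] where
  /-- The distinguished finite set of simple objects. -/
  S : Finset D
  simple : ∀ i : S, Simple (i : D)
  eq_of_iso : ∀ i j : S, Nonempty ((i : D) ≅ (j : D)) → i = j
  unit_mem : 𝟙_ D ∈ S
  rank_hom : ∀ i j : S, Module.rank k ((i : D) ⟶ (j : D)) = if i = j then 1 else 0
  exists_bar : ∀ i : S, ∃! i' : S, ∀ j : S,
    Module.rank k ((j : D) ⊗ (i' : D) ⟶ 𝟙_ D) = (if i = j then 1 else 0) ∧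
    Module.rank k ((i' : D) ⊗ (j : D) ⟶ 𝟙_ D) = (if i = j then 1 else 0)
  isSum_tensor : ∀ x : D, ∃ (n : ℕ) (y : Fin n → D) (B : Bicone y),
    (∀ a, IsTensorProductOf (S : Set D) (y a)) ∧ Nonempty B.IsBilimit ∧ B.pt = x
  iso_sum : ∀ x : D, ∃ (n : ℕ) (s : Fin n → S) (B : Bicone fun a => (s a : D)),
    Nonempty B.IsBilimit ∧ Nonempty (x ≅ B.pt)

section LinearMaps

variable {k : Type w} [Field k] {D : Type u} [Category.{v} D] [Preadditive D] [Linear k D]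

/-- Bilinear composition of morphisms, in diagrammatic order. -/
def compBilin (k : Type w) [Field k] {D : Type u} [Category.{v} D] [Preadditive D] [Linear k D]
    (x y z : D) : (x ⟶ y) →ₗ[k] (y ⟶ z) →ₗ[k] (x ⟶ z) :=
  LinearMap.mk₂ k (fun f g => f ≫ g) (by simp) (by simp) (by simp) (by simp)

/-- A finite family of vectors that is biorthogonal to a family of functionals and satisfies the
corresponding completeness relation is a basis. -/
def biorthogonalBasis {V ι : Type*} [AddCommGroup V] [Module k V] [Fintype ι] (e : ι → V)
    (φ : ι → V →ₗ[k] k) (h₁ : ∀ x y, φ x (e y) = if x = y then 1 else 0)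
    (h₂ : ∀ f, ∑ x, φ x f • e x = f) : Module.Basis ι k V :=
  Module.Basis.mk (v := e)
    (by
      rw [Fintype.linearIndependent_iff]
      intro g hg x
      have := congrArg (φ x) hg
      simpa [map_sum, h₁] using this)
    (by
      intro f _
      rw [← h₂ f]
      exact Submodule.sum_mem _ fun x _ =>
        Submodule.smul_mem _ _ (Submodule.subset_span ⟨x, rfl⟩))

end LinearMaps

namespace PreFusionCategory

variable {k : Type w} [Field k] {D : Type u} [Category.{v} D] [Preadditive D]
  [Linear k D] [MonoidalCategory D] [MonoidalPreadditive D] [MonoidalLinear k D]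
  (C : PreFusionCategory k D)

/-- The monoidal unit as an element of `S`. -/
abbrev one : C.S := ⟨𝟙_ D, C.unit_mem⟩

/-- The involution `i ↦ ī` of `S`. -/
def bar (i : C.S) : C.S := (C.exists_bar i).choose

lemma bar_spec (i j : C.S) :
    Module.rank k ((j : D) ⊗ (C.bar i : D) ⟶ 𝟙_ D) = (if i = j then 1 else 0) ∧
    Module.rank k ((C.bar i : D) ⊗ (j : D) ⟶ 𝟙_ D) = (if i = j then 1 else 0) :=
  (C.exists_bar i).choose_spec.1 j

/-- The basic morphism spaces `Hom(i ⊗ j, m)`. -/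
abbrev Hm (i j m : C.S) : Type v := (i : D) ⊗ (j : D) ⟶ (m : D)

/-- The basic morphism spaces `Hom(m, i ⊗ j)`. -/
abbrev Hd (i j m : C.S) : Type v := (m : D) ⟶ (i : D) ⊗ (j : D)

/-- The multiplicities `N_{ij}^m`. -/
def N (i j m : C.S) : ℕ := Module.finrank k (C.Hm i j m)

lemma N_eval (i : C.S) : C.N i (C.bar i) C.one = 1 := by
  have h := (C.bar_spec i i).1
  simp only [if_true] at h
  exact Module.rank_eq_one_iff_finrank_eq_one.1 h

lemma N_eval' (i : C.S) : C.N (C.bar i) i C.one = 1 := by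
  have h := (C.bar_spec i i).2
  simp only [if_true] at h
  exact Module.rank_eq_one_iff_finrank_eq_one.1 h

lemma id_ne_zero (m : C.S) : 𝟙 (m : D) ≠ 0 :=
  haveI := C.simple m
  id_nonzero (m : D)

/-- The identification `Hom(m, m) = k` for `m ∈ S`, which sends `c • 𝟙` to `c`. -/
def scalar (m : C.S) : ((m : D) ⟶ (m : D)) →ₗ[k] k :=
  (FiniteDimensional.basisSingleton Unit
    (Module.rank_eq_one_iff_finrank_eq_one.1 ((C.rank_hom m m).trans (if_pos rfl)))
    (𝟙 (m : D)) (C.id_ne_zero m)).coord ()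

lemma scalar_smul_id (m : C.S) (f : (m : D) ⟶ (m : D)) : C.scalar m f • 𝟙 (m : D) = f := by
  have h := (FiniteDimensional.basisSingleton Unit
    (Module.rank_eq_one_iff_finrank_eq_one.1 ((C.rank_hom m m).trans (if_pos rfl)))
    (𝟙 (m : D)) (C.id_ne_zero m)).sum_repr f
  simpa [scalar] using h

lemma scalar_id (m : C.S) : C.scalar m (𝟙 (m : D)) = 1 := by
  have h := C.scalar_smul_id m (𝟙 (m : D))
  by_contra hne
  have h2 : (C.scalar m (𝟙 (m : D)) - 1) • 𝟙 (m : D) = 0 := by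
    rw [sub_smul, h, one_smul, sub_self]
  rcases smul_eq_zero.1 h2 with h3 | h3
  · exact hne (sub_eq_zero.1 h3)
  · exact C.id_ne_zero m h3

lemma hom_eq_zero {i j : C.S} (h : i ≠ j) (f : (i : D) ⟶ (j : D)) : f = 0 := by
  have h1 := C.rank_hom i j
  rw [if_neg h, rank_zero_iff] at h1
  exact Subsingleton.elim _ _

instance finite_hom (i j : C.S) : Module.Finite k ((i : D) ⟶ (j : D)) := by
  have h1 := C.rank_hom i j
  apply Module.rank_lt_aleph0_iff.1
  rw [h1]
  split_ifs
  · exact Cardinal.one_lt_aleph0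
  · exact Cardinal.aleph0_pos

lemma exists_decomp (x : D) : ∃ (n : ℕ) (s : Fin n → C.S) (p : ∀ a, x ⟶ (s a : D))
    (q : ∀ a, (s a : D) ⟶ x), ∑ a, p a ≫ q a = 𝟙 x := by
  obtain ⟨n, s, B, ⟨hB⟩, ⟨e⟩⟩ := C.iso_sum x
  refine ⟨n, s, fun a => e.hom ≫ B.π a, fun a => B.ι a ≫ e.inv, ?_⟩
  have h := IsBilimit.total hB
  calc ∑ a, (e.hom ≫ B.π a) ≫ B.ι a ≫ e.inv
      = e.hom ≫ (∑ a, B.π a ≫ B.ι a) ≫ e.inv := by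
        simp [Preadditive.comp_sum, Preadditive.sum_comp]
    _ = 𝟙 x := by rw [h]; simp

instance finite_hom_to (x : D) (m : C.S) : Module.Finite k (x ⟶ (m : D)) := by
  obtain ⟨n, s, p, q, h⟩ := C.exists_decomp x
  let F : (x ⟶ (m : D)) →ₗ[k] (∀ a, (s a : D) ⟶ (m : D)) :=
    LinearMap.pi fun a => compBilin k (s a : D) x (m : D) (q a)
  refine Module.Finite.of_injective F ?_
  rw [injective_iff_map_eq_zero]
  intro f hf
  have h1 : ∀ a, q a ≫ f = 0 := fun a => congrFun hf a
  have h2 := Category.id_comp f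
  rw [← h2, ← h, Preadditive.sum_comp]
  simp [h1]

/-- The pairing `(g, f) ↦ f ∘ g ∈ Hom(m, m) = k` for `g : m ⟶ x` and `f : x ⟶ m`. -/
def pairing (x : D) (m : C.S) : ((m : D) ⟶ x) →ₗ[k] (x ⟶ (m : D)) →ₗ[k] k :=
  (compBilin k (m : D) x (m : D)).compr₂ (C.scalar m)

lemma pairing_apply (x : D) (m : C.S) (g : (m : D) ⟶ x) (f : x ⟶ (m : D)) :
    C.pairing x m g f = C.scalar m (g ≫ f) := rfl

instance pairing_perfect (x : D) (m : C.S) : (C.pairing x m).IsPerfPair := by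
  obtain ⟨n, s, p, q, h⟩ := C.exists_decomp x
  have key : ∀ f : (m : D) ⟶ (m : D), C.scalar m f = 0 → f = 0 := fun f hf => by
    rw [← C.scalar_smul_id m f, hf, zero_smul]
  apply LinearMap.IsPerfPair.of_injective'
  · rw [injective_iff_map_eq_zero]
    intro g hg
    have h1 : ∀ f : x ⟶ (m : D), g ≫ f = 0 := fun f => key _ (LinearMap.congr_fun hg f)
    have h2 : ∀ a, g ≫ p a = 0 := fun a => by
      by_cases ha : m = s a
      · have : ∀ (m' : C.S) (_ : m = m') (f : x ⟶ (m' : D)), g ≫ f = 0 := by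
          rintro _ rfl f; exact h1 f
        exact this _ ha _
      · exact C.hom_eq_zero ha _
    rw [← Category.comp_id g, ← h, Preadditive.comp_sum]
    exact Finset.sum_eq_zero fun a _ => by rw [← Category.assoc, h2, zero_comp]
  · rw [injective_iff_map_eq_zero]
    intro f hf
    have h1 : ∀ g : (m : D) ⟶ x, g ≫ f = 0 := fun g => key _ (LinearMap.congr_fun hf g)
    have h2 : ∀ a, q a ≫ f = 0 := fun a => by
      by_cases ha : m = s a
      · have : ∀ (m' : C.S) (_ : m = m') (g : (m' : D) ⟶ x), g ≫ f = 0 := by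
          rintro _ rfl g; exact h1 g
        exact this _ ha _
      · exact C.hom_eq_zero (Ne.symm ha) _
    rw [← Category.id_comp f, ← h, Preadditive.sum_comp]
    exact Finset.sum_eq_zero fun a _ => by rw [Category.assoc, h2, comp_zero]

section DualBasis

variable {C} {x : D} {m : C.S} {ι : Type*} [Fintype ι]

/-- The covector dual `{ᾱ}` in `Hom(m, x)` of a basis `{α}` of `Hom(x, m)`. -/
def dualBasis (b : Module.Basis ι k (x ⟶ (m : D))) : Module.Basis ι k ((m : D) ⟶ x) :=
  b.dualBasis.map (C.pairing x m).toPerfPair.symm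

lemma scalar_dualBasis_comp (b : Module.Basis ι k (x ⟶ (m : D))) (α : ι) (f : x ⟶ (m : D)) :
    C.scalar m (dualBasis b α ≫ f) = b.repr f α := by
  rw [← pairing_apply]
  have : C.pairing x m (dualBasis b α) = b.coord α := by
    simp [dualBasis]
  rw [this]; rfl

/-- The defining property `α' ∘ ᾱ = δ_{α,α'} id` of the dual basis. -/
lemma dualBasis_comp (b : Module.Basis ι k (x ⟶ (m : D))) (α β : ι) :
    dualBasis b α ≫ b β = if α = β then 𝟙 (m : D) else 0 := by
  rw [← C.scalar_smul_id m (dualBasis b α ≫ b β), scalar_dualBasis_comp]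
  by_cases h : α = β
  · simp [h]
  · simp [h]

/-- Completeness: the identity of `x` is the sum over `m ∈ S` of `∑ ᾱ ∘ α`. -/
lemma completeness {κ : C.S → Type*} [∀ m, Fintype (κ m)]
    (b : ∀ m : C.S, Module.Basis (κ m) k (x ⟶ (m : D))) :
    ∑ m, ∑ α, b m α ≫ dualBasis (b m) α = 𝟙 x := by
  set T := ∑ m, ∑ α, b m α ≫ dualBasis (b m) α with hT
  have hb : ∀ (m : C.S) (f : x ⟶ (m : D)), T ≫ f = f := by
    intro m f
    rw [hT, Preadditive.sum_comp, Finset.sum_eq_single m]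
    · rw [Preadditive.sum_comp]
      conv_rhs => rw [← (b m).sum_repr f]
      refine Finset.sum_congr rfl fun α _ => ?_
      rw [Category.assoc, ← C.scalar_smul_id m (dualBasis (b m) α ≫ f), scalar_dualBasis_comp,
        Linear.comp_smul, Category.comp_id]
    · intro m' _ hm'
      rw [Preadditive.sum_comp]
      exact Finset.sum_eq_zero fun α _ => by
        rw [Category.assoc, C.hom_eq_zero hm' (dualBasis (b m') α ≫ f), comp_zero]
    · intro h; exact absurd (Finset.mem_univ _) h
  obtain ⟨n, s, p, q, h⟩ := C.exists_decomp x
  calc T = T ≫ ∑ a, p a ≫ q a := by rw [h, Category.comp_id]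
    _ = ∑ a, p a ≫ q a := by
        rw [Preadditive.comp_sum]
        exact Finset.sum_congr rfl fun a _ => by rw [← Category.assoc, hb]
    _ = 𝟙 x := h

end DualBasis

/-- A choice of bases of all spaces `Hom(i ⊗ j, m)` such that the basis of the one-dimensional
spaces `Hom(i ⊗ 1, i)` and `Hom(1 ⊗ i, i)` is the (coherent) identity. -/
structure Framing where
  /-- The chosen bases. -/
  basis : ∀ i j m : C.S, Module.Basis (Fin (C.N i j m)) k (C.Hm i j m)
  right_unit : ∀ (i : C.S) (α : Fin (C.N i C.one i)), basis i C.one i α = (ρ_ (i : D)).hom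
  left_unit : ∀ (i : C.S) (α : Fin (C.N C.one i i)), basis C.one i i α = (λ_ (i : D)).hom

namespace Framing

variable {C} (b : C.Framing)

/-- The covector dual bases of the spaces `Hom(m, i ⊗ j)`. -/
def dbasis (i j m : C.S) : Module.Basis (Fin (C.N i j m)) k (C.Hd i j m) :=
  dualBasis (b.basis i j m)

/-- Labels `(q, γ, δ)` of the morphisms `δ ∘ (γ ⊗ id_r)` with `γ : i ⊗ j ⟶ q`, `δ : q ⊗ r ⟶ l`. -/
abbrev LeftIdx (_b : C.Framing) (i j r l : C.S) : Type _ :=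
  Σ q : C.S, Fin (C.N i j q) × Fin (C.N q r l)

/-- Labels `(p, α, β)` of the morphisms `α ∘ (id_i ⊗ β)` with `β : j ⊗ r ⟶ p`,
`α : i ⊗ p ⟶ l`. -/
abbrev RightIdx (_b : C.Framing) (i j r l : C.S) : Type _ :=
  Σ p : C.S, Fin (C.N i p l) × Fin (C.N j r p)

/-- The basis `δ ∘ (γ ⊗ id_r)` of `Hom((i ⊗ j) ⊗ r, l)`. -/
def leftBasis (i j r l : C.S) : Module.Basis (b.LeftIdx i j r l) k
    (((i : D) ⊗ (j : D)) ⊗ (r : D) ⟶ (l : D)) :=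
  biorthogonalBasis
    (fun z => (b.basis i j z.1 z.2.1) ▷ (r : D) ≫ b.basis z.1 r l z.2.2)
    (fun z => C.scalar l ∘ₗ compBilin k _ _ _
      (b.dbasis z.1 r l z.2.2 ≫ (b.dbasis i j z.1 z.2.1) ▷ (r : D)))
    (by
      rintro ⟨q, γ, δ⟩ ⟨q', γ', δ'⟩
      change C.scalar l ((b.dbasis q r l δ ≫ b.dbasis i j q γ ▷ (r : D)) ≫
        b.basis i j q' γ' ▷ (r : D) ≫ b.basis q' r l δ') = _
      rw [Category.assoc, ← comp_whiskerRight_assoc]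
      by_cases hq : q = q'
      · subst hq
        rw [dbasis, dbasis, dualBasis_comp]
        by_cases hγ : γ = γ'
        · subst hγ
          rw [if_pos rfl, id_whiskerRight, Category.id_comp, dualBasis_comp]
          by_cases hδ : δ = δ'
          · subst hδ; simp [scalar_id]
          · simp [hδ]
        · simp [hγ]
      · rw [C.hom_eq_zero hq (b.dbasis i j q γ ≫ b.basis i j q' γ')]
        simp [hq])
    (by
      intro f
      have h := completeness (fun m : C.S => b.basis i j m)
      rw [Fintype.sum_sigma]
      conv_rhs => rw [← Category.id_comp f, ← id_whiskerRight, ← h]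
      rw [sum_whiskerRight, Preadditive.sum_comp]
      refine Finset.sum_congr rfl fun q _ => ?_
      rw [sum_whiskerRight, Preadditive.sum_comp, Fintype.sum_prod_type]
      refine Finset.sum_congr rfl fun γ _ => ?_
      rw [comp_whiskerRight, Category.assoc,
        ← (b.basis q r l).sum_repr (dualBasis (b.basis i j q) γ ▷ (r : D) ≫ f),
        Preadditive.comp_sum]
      refine Finset.sum_congr rfl fun δ _ => ?_
      rw [← scalar_dualBasis_comp, Linear.comp_smul]
      change C.scalar l ((b.dbasis q r l δ ≫ b.dbasis i j q γ ▷ (r : D)) ≫ f) • _ = _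
      rw [Category.assoc]; rfl)

/-- The basis `α ∘ (id_i ⊗ β)` of `Hom(i ⊗ (j ⊗ r), l)`. -/
def rightBasis (i j r l : C.S) : Module.Basis (b.RightIdx i j r l) k
    ((i : D) ⊗ ((j : D) ⊗ (r : D)) ⟶ (l : D)) :=
  biorthogonalBasis
    (fun z => (i : D) ◁ (b.basis j r z.1 z.2.2) ≫ b.basis i z.1 l z.2.1)
    (fun z => C.scalar l ∘ₗ compBilin k _ _ _
      (b.dbasis i z.1 l z.2.1 ≫ (i : D) ◁ (b.dbasis j r z.1 z.2.2)))
    (by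
      rintro ⟨p, α, β⟩ ⟨p', α', β'⟩
      change C.scalar l ((b.dbasis i p l α ≫ (i : D) ◁ b.dbasis j r p β) ≫
        (i : D) ◁ b.basis j r p' β' ≫ b.basis i p' l α') = _
      rw [Category.assoc, ← whiskerLeft_comp_assoc]
      by_cases hp : p = p'
      · subst hp
        rw [dbasis, dbasis, dualBasis_comp]
        by_cases hβ : β = β'
        · subst hβ
          rw [if_pos rfl, whiskerLeft_id, Category.id_comp, dualBasis_comp]
          by_cases hα : α = α'
          · subst hα; simp [scalar_id]
          · simp [hα]
        · simp [hβ]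
      · rw [C.hom_eq_zero hp (b.dbasis j r p β ≫ b.basis j r p' β')]
        simp [hp])
    (by
      intro f
      have h := completeness (fun m : C.S => b.basis j r m)
      rw [Fintype.sum_sigma]
      conv_rhs => rw [← Category.id_comp f, ← whiskerLeft_id, ← h]
      rw [whiskerLeft_sum, Preadditive.sum_comp]
      refine Finset.sum_congr rfl fun p _ => ?_
      rw [whiskerLeft_sum, Preadditive.sum_comp, Fintype.sum_prod_type_right]
      refine Finset.sum_congr rfl fun β _ => ?_
      rw [whiskerLeft_comp, Category.assoc,
        ← (b.basis i p l).sum_repr ((i : D) ◁ dualBasis (b.basis j r p) β ≫ f),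
        Preadditive.comp_sum]
      refine Finset.sum_congr rfl fun α _ => ?_
      rw [← scalar_dualBasis_comp, Linear.comp_smul]
      change C.scalar l ((b.dbasis i p l α ≫ (i : D) ◁ b.dbasis j r p β) ≫ f) • _ = _
      rw [Category.assoc]; rfl)

lemma leftBasis_apply (i j r l q : C.S) (γ : Fin (C.N i j q)) (δ : Fin (C.N q r l)) :
    b.leftBasis i j r l ⟨q, γ, δ⟩ = (b.basis i j q γ) ▷ (r : D) ≫ b.basis q r l δ := by
  simp [leftBasis, biorthogonalBasis]

lemma rightBasis_apply (i j r l p : C.S) (α : Fin (C.N i p l)) (β : Fin (C.N j r p)) :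
    b.rightBasis i j r l ⟨p, α, β⟩ = (i : D) ◁ (b.basis j r p β) ≫ b.basis i p l α := by
  simp [rightBasis, biorthogonalBasis]

/-- The `6j`-symbol `F^{(i j r) l}_{α p β, γ q δ}`: the coefficient of `δ ∘ (γ ⊗ id_r)` in the
expansion of `α ∘ (id_i ⊗ β) ∘ a_{i,j,r}`. -/
def sixJ (i j r l p q : C.S) (α : Fin (C.N i p l)) (β : Fin (C.N j r p))
    (γ : Fin (C.N i j q)) (δ : Fin (C.N q r l)) : k :=
  (b.leftBasis i j r l).repr
    ((α_ (i : D) (j : D) (r : D)).hom ≫ (i : D) ◁ (b.basis j r p β) ≫ b.basis i p l α) ⟨q, γ, δ⟩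

/-- The inverse `6j`-symbol `G^{(i j r) l}_{α p β, γ q δ}`: the coefficient of `γ ∘ (id_i ⊗ δ)` in
the expansion of `β ∘ (α ⊗ id_r) ∘ a⁻¹_{i,j,r}`. -/
def sixJInv (i j r l p q : C.S) (α : Fin (C.N i j p)) (β : Fin (C.N p r l))
    (γ : Fin (C.N i q l)) (δ : Fin (C.N j r q)) : k :=
  (b.rightBasis i j r l).repr
    ((α_ (i : D) (j : D) (r : D)).inv ≫ (b.basis i j p α) ▷ (r : D) ≫ b.basis p r l β) ⟨q, γ, δ⟩

/-- The chosen basis vector of the one-dimensional space `Hom(i ⊗ ī, 1)`. -/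
def ev (i : C.S) : (i : D) ⊗ (C.bar i : D) ⟶ 𝟙_ D :=
  b.basis i (C.bar i) C.one (Fin.cast (C.N_eval i).symm 0)

/-- The chosen basis vector of the one-dimensional space `Hom(ī ⊗ i, 1)`. -/
def ev' (i : C.S) : (C.bar i : D) ⊗ (i : D) ⟶ 𝟙_ D :=
  b.basis (C.bar i) i C.one (Fin.cast (C.N_eval' i).symm 0)

/-- The dual basis vector of the one-dimensional space `Hom(1, i ⊗ ī)`. -/
def coev (i : C.S) : 𝟙_ D ⟶ (i : D) ⊗ (C.bar i : D) :=
  b.dbasis i (C.bar i) C.one (Fin.cast (C.N_eval i).symm 0)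

/-- The dual basis vector of the one-dimensional space `Hom(1, ī ⊗ i)`. -/
def coev' (i : C.S) : 𝟙_ D ⟶ (C.bar i : D) ⊗ (i : D) :=
  b.dbasis (C.bar i) i C.one (Fin.cast (C.N_eval' i).symm 0)

end Framing

lemma N_right_unit (i : C.S) : C.N i C.one i = 1 := by
  have e : ((i : D) ⟶ (i : D)) ≃ₗ[k] C.Hm i C.one i :=
    Linear.homCongr k (ρ_ (i : D)).symm (Iso.refl (i : D))
  rw [N, ← e.finrank_eq]
  exact Module.rank_eq_one_iff_finrank_eq_one.1 ((C.rank_hom i i).trans (if_pos rfl))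

lemma N_left_unit (i : C.S) : C.N C.one i i = 1 := by
  have e : ((i : D) ⟶ (i : D)) ≃ₗ[k] C.Hm C.one i i :=
    Linear.homCongr k (λ_ (i : D)).symm (Iso.refl (i : D))
  rw [N, ← e.finrank_eq]
  exact Module.rank_eq_one_iff_finrank_eq_one.1 ((C.rank_hom i i).trans (if_pos rfl))

namespace Framing

variable {C} (b : C.Framing)

/-- The special `6j`-symbols `F_i = F^{(i ī i) i}_{1,1}`. -/
def F₀ (i : C.S) : k :=
  b.sixJ i (C.bar i) i i C.one C.one
    (Fin.cast (C.N_right_unit i).symm 0) (Fin.cast (C.N_eval' i).symm 0)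
    (Fin.cast (C.N_eval i).symm 0) (Fin.cast (C.N_left_unit i).symm 0)

/-- The non-degeneracy condition that makes `D` a veined fusion category: all `F_i` are
invertible. -/
def IsVeined : Prop := ∀ i : C.S, IsUnit (b.F₀ i)

variable (μ : C.S → kˣ)

/-- The rigidity morphism `∪_i = μ_i • ō_i : 1 ⟶ ī ⊗ i`. -/
def cup' (i : C.S) : 𝟙_ D ⟶ (C.bar i : D) ⊗ (i : D) := (μ i : k) • b.coev' i

/-- The rigidity morphism `∪_ī : 1 ⟶ i ⊗ ī` (using that the dual of `ī` is `i`). -/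
def cup (i : C.S) : 𝟙_ D ⟶ (i : D) ⊗ (C.bar i : D) := (μ (C.bar i) : k) • b.coev i

/-- The rigidity morphism `∩_i = (μ_i F_ī)⁻¹ • o_i : i ⊗ ī ⟶ 1`. -/
def cap (i : C.S) : (i : D) ⊗ (C.bar i : D) ⟶ 𝟙_ D :=
  ((μ i : k) * b.F₀ (C.bar i))⁻¹ • b.ev i

/-- The rigidity morphism `∩_ī = (μ_ī F_i)⁻¹ • o_ī : ī ⊗ i ⟶ 1` (using that the dual of `ī` is
`i`). -/
def cap' (i : C.S) : (C.bar i : D) ⊗ (i : D) ⟶ 𝟙_ D :=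
  ((μ (C.bar i) : k) * b.F₀ i)⁻¹ • b.ev' i

/-- The left dimension: the left trace `∩_i ∘ ∪_ī` of `id_i`. -/
def dimL (i : C.S) : k := C.scalar C.one (b.cup μ i ≫ b.cap μ i)

/-- The right dimension: the right trace `∩_ī ∘ ∪_i` of `id_i`. -/
def dimR (i : C.S) : k := C.scalar C.one (b.cup' μ i ≫ b.cap' μ i)

end Framing

/-- The right dual `y' ⟶ x'` of a morphism `f : x ⟶ y` with respect to `e : y' ⊗ y ⟶ 1` and
`c : 1 ⟶ x ⊗ x'`. -/
def _root_.Veined.mate {D : Type u} [Category.{v} D] [MonoidalCategory D] {x x' y y' : D}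
    (e : y' ⊗ y ⟶ 𝟙_ D) (c : 𝟙_ D ⟶ x ⊗ x') (f : x ⟶ y) : y' ⟶ x' :=
  (ρ_ y').inv ≫ y' ◁ c ≫ y' ◁ (f ▷ x') ≫ (α_ y' y x').inv ≫ e ▷ x' ≫ (λ_ x').hom

/-- The nested evaluation `(y' ⊗ x') ⊗ (x ⊗ y) ⟶ 1`. -/
def _root_.Veined.nestEv {D : Type u} [Category.{v} D] [MonoidalCategory D] {x x' y y' : D}
    (e₁ : x' ⊗ x ⟶ 𝟙_ D) (e₂ : y' ⊗ y ⟶ 𝟙_ D) : (y' ⊗ x') ⊗ (x ⊗ y) ⟶ 𝟙_ D :=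
  (α_ y' x' (x ⊗ y)).hom ≫ y' ◁ (α_ x' x y).inv ≫ y' ◁ (e₁ ▷ y) ≫ y' ◁ (λ_ y).hom ≫ e₂

/-- The nested coevaluation `1 ⟶ (x ⊗ y) ⊗ (y' ⊗ x')`. -/
def _root_.Veined.nestCoev {D : Type u} [Category.{v} D] [MonoidalCategory D] {x x' y y' : D}
    (c₁ : 𝟙_ D ⟶ x ⊗ x') (c₂ : 𝟙_ D ⟶ y ⊗ y') : 𝟙_ D ⟶ (x ⊗ y) ⊗ (y' ⊗ x') :=
  c₁ ≫ x ◁ (λ_ x').inv ≫ x ◁ (c₂ ▷ x') ≫ x ◁ (α_ y y' x').hom ≫ (α_ x y (y' ⊗ x')).inv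

namespace Framing

variable {C} (b : C.Framing) (μ : C.S → kˣ)

/-- The right dual `α^∨ : m̄ ⟶ j̄ ⊗ ī` of `α : i ⊗ j ⟶ m`. -/
def rdual {i j m : C.S} (α : C.Hm i j m) :
    (C.bar m : D) ⟶ (C.bar j : D) ⊗ (C.bar i : D) :=
  mate (b.cap' μ m) (nestCoev (b.cup μ i) (b.cup μ j)) α

/-- The right double dual `α^∨∨ : i ⊗ j ⟶ m` of `α : i ⊗ j ⟶ m`: the right dual of `α^∨`, where
`i` is the right dual of `ī`, with evaluation `∩_i` and coevaluation `∪_i`. -/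
def doubleDual {i j m : C.S} (α : C.Hm i j m) : C.Hm i j m :=
  mate (nestEv (b.cap μ j) (b.cap μ i)) (b.cup' μ m) (b.rdual μ α)

/-- A choice of square roots of the paired dimensions `d_i d_ī` (with `d_i` the left dimension),
depending only on the pair `{i, ī}`, and equal to the obvious root `d_i` of `d_i ^ 2` if
`d_i = d_ī`. -/
structure RootChoice where
  /-- The chosen root of `d_i d_ī`. -/
  root : C.S → k
  sq : ∀ i, root i ^ 2 = b.dimL μ i * b.dimL μ (C.bar i)
  root_bar : ∀ i, root (C.bar i) = root i
  root_of_eq : ∀ i, b.dimL μ i = b.dimL μ (C.bar i) → root i = b.dimL μ i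

variable {b μ}

/-- The induced square root `d_i / √(d_i d_ī)` of the relative dimension `d_i / d_ī`. -/
def RootChoice.relRoot (s : b.RootChoice μ) (i : C.S) : k := b.dimL μ i / s.root i

/-- `ε` is the sign of the double-dual eigenvector `α : i ⊗ j ⟶ m`, i.e.
`α^∨∨ = ε √(d_i/d_ī) √(d_j/d_j̄) √(d_m̄/d_m) α`. -/
def RootChoice.IsSign (s : b.RootChoice μ) {i j m : C.S} (α : C.Hm i j m) (ε : k) : Prop :=
  α ≠ 0 ∧ (ε = 1 ∨ ε = -1) ∧
    b.doubleDual μ α = (ε * (s.relRoot i * s.relRoot j * s.relRoot (C.bar m))) • α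

variable (b μ)

/-- The modified framed partial left dual on `Hom(i ⊗ j, m)`. -/
def Lm (i j m : C.S) : C.Hm i j m →ₗ[k] C.Hd (C.bar i) m j where
  toFun α := (λ_ (j : D)).inv ≫ b.cup' μ i ▷ (j : D) ≫
    (α_ (C.bar i : D) (i : D) (j : D)).hom ≫ (C.bar i : D) ◁ α
  map_add' := by simp
  map_smul' := by simp

/-- The modified framed partial left dual on `Hom(m, i ⊗ j)`. -/
def Ld (i j m : C.S) : C.Hd i j m →ₗ[k] C.Hm (C.bar i) m j where
  toFun α := (C.bar i : D) ◁ α ≫ (α_ (C.bar i : D) (i : D) (j : D)).inv ≫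
    b.cap' μ i ▷ (j : D) ≫ (λ_ (j : D)).hom
  map_add' := by simp
  map_smul' := by simp

/-- The modified framed partial right dual on `Hom(i ⊗ j, m)`. -/
def Rm (i j m : C.S) : C.Hm i j m →ₗ[k] C.Hd m (C.bar j) i where
  toFun α := (ρ_ (i : D)).inv ≫ (i : D) ◁ b.cup μ j ≫
    (α_ (i : D) (j : D) (C.bar j : D)).inv ≫ α ▷ (C.bar j : D)
  map_add' := by simp
  map_smul' := by simp

/-- The modified framed partial right dual on `Hom(m, i ⊗ j)`. -/
def Rd (i j m : C.S) : C.Hd i j m →ₗ[k] C.Hm m (C.bar j) i where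
  toFun α := α ▷ (C.bar j : D) ≫ (α_ (i : D) (j : D) (C.bar j : D)).hom ≫
    (i : D) ◁ b.cap μ j ≫ (ρ_ (i : D)).hom
  map_add' := by simp
  map_smul' := by simp

end Framing

/-- Labels `(i j r) l, p, q` of the summands of `H⁽⁴⁾`. -/
structure Idx where
  (i j r l p q : C.S)

variable {C} in
/-- The summand `Hom(j ⊗ r, p) ⊗ Hom(l, q ⊗ r) ⊗ Hom(i ⊗ p, l) ⊗ Hom(q, i ⊗ j)`. -/
abbrev HF (t : C.Idx) : Type _ :=
  C.Hm t.j t.r t.p ⊗[k] (C.Hd t.q t.r t.l ⊗[k] (C.Hm t.i t.p t.l ⊗[k] C.Hd t.i t.j t.q))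

variable {C} in
/-- The summand `Hom(p, j ⊗ r) ⊗ Hom(q ⊗ r, l) ⊗ Hom(l, i ⊗ p) ⊗ Hom(i ⊗ j, q)`. -/
abbrev HG (t : C.Idx) : Type _ :=
  C.Hd t.j t.r t.p ⊗[k] (C.Hm t.q t.r t.l ⊗[k] (C.Hd t.i t.p t.l ⊗[k] C.Hm t.i t.j t.q))

/-- The space `H⁽⁴⁾`. -/
abbrev H4 : Type _ := DirectSum C.Idx fun t => HF t × HG t

variable {C} in
/-- The inclusion of the summand `HF t`. -/
def inF (t : C.Idx) : HF t →ₗ[k] C.H4 :=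
  DirectSum.lof k C.Idx (fun t => HF t × HG t) t ∘ₗ LinearMap.inl k (HF t) (HG t)

variable {C} in
/-- The inclusion of the summand `HG t`. -/
def inG (t : C.Idx) : HG t →ₗ[k] C.H4 :=
  DirectSum.lof k C.Idx (fun t => HF t × HG t) t ∘ₗ LinearMap.inr k (HF t) (HG t)

section Permute

variable {V₁ V₂ V₃ V₄ W₁ W₂ W₃ W₄ : Type*}
  [AddCommGroup V₁] [Module k V₁] [AddCommGroup V₂] [Module k V₂]
  [AddCommGroup V₃] [Module k V₃] [AddCommGroup V₄] [Module k V₄]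
  [AddCommGroup W₁] [Module k W₁] [AddCommGroup W₂] [Module k W₂]
  [AddCommGroup W₃] [Module k W₃] [AddCommGroup W₄] [Module k W₄]

/-- `v₁ ⊗ v₂ ⊗ v₃ ⊗ v₄ ↦ v₂ ⊗ v₁ ⊗ f v₃ ⊗ g v₄`. -/
def _root_.Veined.permute12 (f : V₃ →ₗ[k] W₃) (g : V₄ →ₗ[k] W₄) :
    V₁ ⊗[k] (V₂ ⊗[k] (V₃ ⊗[k] V₄)) →ₗ[k] V₂ ⊗[k] (V₁ ⊗[k] (W₃ ⊗[k] W₄)) :=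
  (TensorProduct.leftComm k V₁ V₂ (W₃ ⊗[k] W₄)).toLinearMap ∘ₗ
    TensorProduct.map LinearMap.id (TensorProduct.map LinearMap.id (TensorProduct.map f g))

/-- `v₁ ⊗ v₂ ⊗ v₃ ⊗ v₄ ↦ f v₁ ⊗ v₃ ⊗ v₂ ⊗ g v₄`. -/
def _root_.Veined.permute23 (f : V₁ →ₗ[k] W₁) (g : V₄ →ₗ[k] W₄) :
    V₁ ⊗[k] (V₂ ⊗[k] (V₃ ⊗[k] V₄)) →ₗ[k] W₁ ⊗[k] (V₃ ⊗[k] (V₂ ⊗[k] W₄)) :=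
  TensorProduct.map f ((TensorProduct.leftComm k V₂ V₃ W₄).toLinearMap ∘ₗ
    TensorProduct.map LinearMap.id (TensorProduct.map LinearMap.id g))

/-- `v₁ ⊗ v₂ ⊗ v₃ ⊗ v₄ ↦ f v₁ ⊗ g v₂ ⊗ v₄ ⊗ v₃`. -/
def _root_.Veined.permute34 (f : V₁ →ₗ[k] W₁) (g : V₂ →ₗ[k] W₂) :
    V₁ ⊗[k] (V₂ ⊗[k] (V₃ ⊗[k] V₄)) →ₗ[k] W₁ ⊗[k] (W₂ ⊗[k] (V₄ ⊗[k] V₃)) :=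
  TensorProduct.map f (TensorProduct.map g (TensorProduct.comm k V₃ V₄).toLinearMap)

lemma _root_.Veined.permute12_tmul (f : V₃ →ₗ[k] W₃) (g : V₄ →ₗ[k] W₄)
    (v₁ : V₁) (v₂ : V₂) (v₃ : V₃) (v₄ : V₄) :
    permute12 f g (v₁ ⊗ₜ[k] (v₂ ⊗ₜ[k] (v₃ ⊗ₜ[k] v₄))) = v₂ ⊗ₜ (v₁ ⊗ₜ (f v₃ ⊗ₜ g v₄)) := by
  simp [permute12]

lemma _root_.Veined.permute23_tmul (f : V₁ →ₗ[k] W₁) (g : V₄ →ₗ[k] W₄)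
    (v₁ : V₁) (v₂ : V₂) (v₃ : V₃) (v₄ : V₄) :
    permute23 f g (v₁ ⊗ₜ[k] (v₂ ⊗ₜ[k] (v₃ ⊗ₜ[k] v₄))) = f v₁ ⊗ₜ (v₃ ⊗ₜ (v₂ ⊗ₜ g v₄)) := by
  simp [permute23]

lemma _root_.Veined.permute34_tmul (f : V₁ →ₗ[k] W₁) (g : V₂ →ₗ[k] W₂)
    (v₁ : V₁) (v₂ : V₂) (v₃ : V₃) (v₄ : V₄) :
    permute34 f g (v₁ ⊗ₜ[k] (v₂ ⊗ₜ[k] (v₃ ⊗ₜ[k] v₄))) = f v₁ ⊗ₜ (g v₂ ⊗ₜ (v₄ ⊗ₜ v₃)) := by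
  simp [permute34]

end Permute

namespace Framing

variable {C} (b : C.Framing) (μ : C.S → kˣ)

/-- The map `τ₁₂` on `H⁽⁴⁾`. -/
def τ12 : C.H4 →ₗ[k] C.H4 :=
  DirectSum.toModule k C.Idx C.H4 fun t =>
    LinearMap.coprod
      (inG ⟨C.bar t.i, t.q, t.r, t.p, t.l, t.j⟩ ∘ₗ
        permute12 (b.Lm μ t.i t.p t.l) (b.Ld μ t.i t.j t.q))
      (inF ⟨C.bar t.i, t.q, t.r, t.p, t.l, t.j⟩ ∘ₗ
        permute12 (b.Ld μ t.i t.p t.l) (b.Lm μ t.i t.j t.q))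

/-- The map `τ₂₃` on `H⁽⁴⁾`. -/
def τ23 : C.H4 →ₗ[k] C.H4 :=
  DirectSum.toModule k C.Idx C.H4 fun t =>
    LinearMap.coprod
      (inG ⟨t.q, C.bar t.j, t.p, t.l, t.r, t.i⟩ ∘ₗ
        permute23 (b.Lm μ t.j t.r t.p) (b.Rd μ t.i t.j t.q))
      (inF ⟨t.q, C.bar t.j, t.p, t.l, t.r, t.i⟩ ∘ₗ
        permute23 (b.Ld μ t.j t.r t.p) (b.Rm μ t.i t.j t.q))

/-- The map `τ₃₄` on `H⁽⁴⁾`. -/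
def τ34 : C.H4 →ₗ[k] C.H4 :=
  DirectSum.toModule k C.Idx C.H4 fun t =>
    LinearMap.coprod
      (inG ⟨t.i, t.p, C.bar t.r, t.q, t.j, t.l⟩ ∘ₗ
        permute34 (b.Rm μ t.j t.r t.p) (b.Rd μ t.q t.r t.l))
      (inF ⟨t.i, t.p, C.bar t.r, t.q, t.j, t.l⟩ ∘ₗ
        permute34 (b.Rd μ t.j t.r t.p) (b.Rm μ t.q t.r t.l))

variable {b μ}

/-- The function `𝔽` on the summand `HF t`: the linear extension of
`β ⊗ δ̄ ⊗ α ⊗ γ̄ ↦ √(d_l d_l̄) F^{(i j r) l}_{α p β, γ q δ}`. -/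
def RootChoice.onHF (s : b.RootChoice μ) (t : C.Idx) : HF t →ₗ[k] k :=
  ((b.basis t.j t.r t.p).tensorProduct ((b.dbasis t.q t.r t.l).tensorProduct
    ((b.basis t.i t.p t.l).tensorProduct (b.dbasis t.i t.j t.q)))).constr k
    fun z => s.root t.l * b.sixJ t.i t.j t.r t.l t.p t.q z.2.2.1 z.1 z.2.2.2 z.2.1

/-- The function `𝔽` on the summand `HG t`: the linear extension of
`β̄ ⊗ δ ⊗ ᾱ ⊗ γ ↦ √(d_l d_l̄) G^{(i j r) l}_{γ q δ, α p β}`. -/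
def RootChoice.onHG (s : b.RootChoice μ) (t : C.Idx) : HG t →ₗ[k] k :=
  ((b.dbasis t.j t.r t.p).tensorProduct ((b.basis t.q t.r t.l).tensorProduct
    ((b.dbasis t.i t.p t.l).tensorProduct (b.basis t.i t.j t.q)))).constr k
    fun z => s.root t.l * b.sixJInv t.i t.j t.r t.l t.q t.p z.2.2.2 z.2.1 z.2.2.1 z.1

/-- The rescaled `6j`-symbol function `𝔽` on `H⁽⁴⁾`. -/
def RootChoice.𝔽 (s : b.RootChoice μ) : C.H4 →ₗ[k] k :=
  DirectSum.toModule k C.Idx k fun t => LinearMap.coprod (s.onHF t) (s.onHG t)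

end Framing

end PreFusionCategory

end Veined

end

/-! Endomorphisms of a simple object are scalars, so a 6j-symbol is the scalar of a composite of
four morphisms: on a pure tensor, `𝔽` is √(d_l d_l̄) times the scalar of an endomorphism of l
assembled from the four factors (`𝔽_pureF`, `𝔽_pureG`). Invertibility of the F_i makes cups and caps
satisfy the triangle identities (`cup_cap'_isDuality`), so that everything reduces to bending
strands.

Group relations. L and R are involutive, which makes the τ's involutions, and τ₁₂ and τ₃₄ commute
without further assumptions. Each braid relation compares LRL with RLR on a single tensor factor,
that is, the left dual with the right dual of a morphism. These agree exactly when the double dual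
fixes the morphism (`doubleDual_eq_iff`). So a trivial double dual gives the Coxeter relations of
𝔖₄, and conversely the braid relation for τ₁₂, τ₂₃ forces a trivial double dual
(`doubleDual_eq_of_braid`).

Invariance. τ₂₃ only moves a strand inside the composite and always preserves `𝔽`. τ₁₂ and τ₃₄ turn
a full closure into a left or right partial trace. Cyclicity of the trace, in which a morphism
carried around the loop returns as its double dual, compares the two up to dimensions
(`scalar_left_partial_trace`, `scalar_right_partial_trace`). With trivial double dual and the roots
equal to the dimensions, this comparison is the invariance.

Dimensions and signs. Given the action, invariance under τ₃₄ evaluated on i ⊗ ī → 1 forces √(d_i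
d_ī) = d_i. The root is the same for i and ī, hence d_i = d_ī = dim_R(i), and then all signs are 1.
Conversely, two-sided dimensions make the quadruple dual trivial (`doubleDual_doubleDual`), so the
double dual is an involution; if it were not the identity it would have an eigenvector of sign -1.
-/

namespace Veined

/-! ### Coxeter presentation of 𝔖₄ by normal forms -/

/-- The normal form `x y z` of an element of a monoid generated by `a`, `b`, `c`, with `x` in
`{1, a}`, `y` in `{1, b, ba}` and `z` in `{1, c, cb, cba}`. -/
def normalWord {M : Type*} [Monoid M] (a b c : M) (w : Fin 2 × Fin 3 × Fin 4) : M :=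
  ![1, a] w.1 * (![1, b, b * a] w.2.1 * ![1, c, c * b, c * b * a] w.2.2)

/-- The normal form of `w * a`. -/
def normalMulA (w : Fin 2 × Fin 3 × Fin 4) : Fin 2 × Fin 3 × Fin 4 :=
  ![![(w.1 + 1, 0, 0), (w.1 + 1, 0, 1), (w.1, 0, 3), (w.1, 0, 2)],
    ![(w.1, 2, 0), (w.1, 2, 1), (w.1, 1, 3), (w.1, 1, 2)],
    ![(w.1, 1, 0), (w.1, 1, 1), (w.1, 2, 3), (w.1, 2, 2)]] w.2.1 w.2.2

/-- The normal form of `w * b`. -/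
def normalMulB (w : Fin 2 × Fin 3 × Fin 4) : Fin 2 × Fin 3 × Fin 4 :=
  ![![(w.1, 1, 0), (w.1, 0, 2), (w.1, 0, 1), (w.1 + 1, 0, 3)],
    ![(w.1, 0, 0), (w.1, 1, 2), (w.1, 1, 1), (w.1, 2, 3)],
    ![(w.1 + 1, 2, 0), (w.1, 2, 2), (w.1, 2, 1), (w.1, 1, 3)]] w.2.1 w.2.2

/-- The normal form of `w * c`. -/
def normalMulC (w : Fin 2 × Fin 3 × Fin 4) : Fin 2 × Fin 3 × Fin 4 :=
  ![![(w.1, 0, 1), (w.1, 0, 0), (w.1, 1, 2), (w.1, 1, 3)],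
    ![(w.1, 1, 1), (w.1, 1, 0), (w.1, 0, 2), (w.1, 0, 3)],
    ![(w.1, 2, 1), (w.1, 2, 0), (w.1 + 1, 2, 2), (w.1 + 1, 2, 3)]] w.2.1 w.2.2

section

variable {M : Type*} [Monoid M] {a b c : M}

/-- A multiplicative predicate that holds for the generators holds for all normal forms. -/
lemma normalWord_induction {P : M → Prop} (h1 : P 1) (hmul : ∀ x y, P x → P y → P (x * y))
    (ha : P a) (hb : P b) (hc : P c) (w : Fin 2 × Fin 3 × Fin 4) : P (normalWord a b c w) := by
  obtain ⟨x, y, z⟩ := w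
  refine hmul _ _ ?_ (hmul _ _ ?_ ?_)
  · fin_cases x
    exacts [h1, ha]
  · fin_cases y
    exacts [h1, hb, hmul _ _ hb ha]
  · fin_cases z
    exacts [h1, hc, hmul _ _ hc hb, hmul _ _ (hmul _ _ hc hb) ha]

/-- The relations alone bring a normal form times a generator back to normal form, by a table that
does not depend on the monoid. The same table therefore applies in 𝔖₄ and in any other monoid
satisfying the relations. -/
lemma normalWord_mul_a (ha : a * a = 1) (hac : a * c = c * a) (w : Fin 2 × Fin 3 × Fin 4) :
    normalWord a b c w * a = normalWord a b c (normalMulA w) := by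
  have ha' : ∀ x, a * (a * x) = x := fun x => by rw [← mul_assoc, ha, one_mul]
  obtain ⟨x, y, z⟩ := w
  fin_cases x <;> fin_cases y <;> fin_cases z <;>
    simp [normalWord, normalMulA, mul_assoc, ha, ha', ← hac]

lemma normalWord_mul_b (ha : a * a = 1) (hb : b * b = 1) (hab : a * b * a = b * a * b)
    (hac : a * c = c * a) (w : Fin 2 × Fin 3 × Fin 4) :
    normalWord a b c w * b = normalWord a b c (normalMulB w) := by
  have ha' : ∀ x, a * (a * x) = x := fun x => by rw [← mul_assoc, ha, one_mul]
  have hab₁ : b * (a * b) = a * (b * a) := by rw [← mul_assoc, ← mul_assoc, hab]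
  have hac' : ∀ x, c * (a * x) = a * (c * x) := fun x => by rw [← mul_assoc, ← hac, mul_assoc]
  obtain ⟨x, y, z⟩ := w
  fin_cases x <;> fin_cases y <;> fin_cases z <;>
    simp [normalWord, normalMulB, mul_assoc, ha', hb, hab₁, hac']

lemma normalWord_mul_c (ha : a * a = 1) (hb : b * b = 1) (hc : c * c = 1)
    (hab : a * b * a = b * a * b) (hbc : b * c * b = c * b * c)
    (hac : a * c = c * a) (w : Fin 2 × Fin 3 × Fin 4) :
    normalWord a b c w * c = normalWord a b c (normalMulC w) := by
  have ha' : ∀ x, a * (a * x) = x := fun x => by rw [← mul_assoc, ha, one_mul]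
  have hb' : ∀ x, b * (b * x) = x := fun x => by rw [← mul_assoc, hb, one_mul]
  have hc' : ∀ x, c * (c * x) = x := fun x => by rw [← mul_assoc, hc, one_mul]
  have hab₁ : ∀ x, b * (a * (b * x)) = a * (b * (a * x)) := fun x => by
    rw [← mul_assoc, ← mul_assoc, ← hab, mul_assoc, mul_assoc]
  have hbc₁ : c * (b * c) = b * (c * b) := by rw [← mul_assoc, ← mul_assoc, hbc]
  have hbc₂ : ∀ x, c * (b * (c * x)) = b * (c * (b * x)) := fun x => by
    rw [← mul_assoc, ← mul_assoc, ← hbc, mul_assoc, mul_assoc]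
  obtain ⟨x, y, z⟩ := w
  fin_cases x <;> fin_cases y <;> fin_cases z <;>
    simp [normalWord, normalMulC, mul_assoc, ha', hb', hc, hc', hab₁, hbc₁, hbc₂, hac]

end

/-- The three factors are coset representatives along 𝔖₂ ⊂ 𝔖₃ ⊂ 𝔖₄, so there are 2 · 3 · 4 = 24
words; distinctness is a finite check. -/
lemma normalWord_swap_bijective : Function.Bijective
    (normalWord (Equiv.swap 0 1 : Equiv.Perm (Fin 4)) (Equiv.swap 1 2) (Equiv.swap 2 3)) := by
  rw [Fintype.bijective_iff_injective_and_card]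
  exact ⟨by decide, by simp [Fintype.card_perm, Nat.factorial]⟩

/-- The Coxeter presentation of the symmetric group on four letters. -/
lemma exists_permFinFour_hom {M : Type*} [Monoid M] {a b c : M} (ha : a * a = 1) (hb : b * b = 1)
    (hc : c * c = 1) (hab : a * b * a = b * a * b) (hbc : b * c * b = c * b * c)
    (hac : a * c = c * a) :
    ∃ ρ : Equiv.Perm (Fin 4) →* M, ρ (Equiv.swap 0 1) = a ∧ ρ (Equiv.swap 1 2) = b ∧
      ρ (Equiv.swap 2 3) = c := by
  set W := normalWord (Equiv.swap 0 1 : Equiv.Perm (Fin 4)) (Equiv.swap 1 2) (Equiv.swap 2 3)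
    with hW
  let e := Equiv.ofBijective W normalWord_swap_bijective
  let f : Equiv.Perm (Fin 4) → M := fun g => normalWord a b c (e.symm g)
  have hf : ∀ w, f (W w) = normalWord a b c w := fun w => by
    simp only [f]
    rw [show W w = e w from rfl, Equiv.symm_apply_apply]
  have hsurj : ∀ g, ∃ w, W w = g := normalWord_swap_bijective.2
  -- Both sides are computed by the same multiplication table, once in 𝔖₄ and once in M.
  have hfa : ∀ g, f (g * Equiv.swap 0 1) = f g * a := fun g => by
    obtain ⟨w, rfl⟩ := hsurj g
    rw [hW, normalWord_mul_a (by decide) (by decide), ← hW, hf, hf, normalWord_mul_a ha hac]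
  have hfb : ∀ g, f (g * Equiv.swap 1 2) = f g * b := fun g => by
    obtain ⟨w, rfl⟩ := hsurj g
    rw [hW, normalWord_mul_b (by decide) (by decide) (by decide) (by decide), ← hW, hf, hf,
      normalWord_mul_b ha hb hab hac]
  have hfc : ∀ g, f (g * Equiv.swap 2 3) = f g * c := fun g => by
    obtain ⟨w, rfl⟩ := hsurj g
    rw [hW, normalWord_mul_c (by decide) (by decide) (by decide) (by decide) (by decide)
      (by decide), ← hW, hf, hf, normalWord_mul_c ha hb hc hab hbc hac]
  have h1 : f 1 = 1 := by
    have := hf (0, 0, 0)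
    simpa [hW, normalWord] using this
  -- Compatibility with right multiplication by each generator suffices: the second argument is
  -- unwound letter by letter.
  have hf' : ∀ g w, f (g * W w) = f g * f (W w) := by
    rintro g ⟨x, y, z⟩
    rw [hf, hW]
    fin_cases x <;> fin_cases y <;> fin_cases z <;>
      simp [normalWord, ← mul_assoc, hfa, hfb, hfc]
  refine ⟨⟨⟨f, h1⟩, fun g h => ?_⟩, ?_, ?_, ?_⟩
  · obtain ⟨w, rfl⟩ := hsurj h
    exact hf' g w
  · simpa [h1] using hfa 1
  · simpa [h1] using hfb 1
  · simpa [h1] using hfc 1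

end Veined

noncomputable section

open scoped Classical

namespace Veined

universe v u w

section

/-! ### String calculus: duals, mates, bending and cyclic traces -/

section Duality

variable {D : Type u} [Category.{v} D] [MonoidalCategory D]

/-- The triangle identities for a coevaluation `c` and an evaluation `e`. -/
structure IsDuality {x x' : D} (c : 𝟙_ D ⟶ x ⊗ x') (e : x' ⊗ x ⟶ 𝟙_ D) : Prop where
  left : x' ◁ c ≫ (α_ _ _ _).inv ≫ e ▷ x' = (ρ_ x').hom ≫ (λ_ x').inv
  right : c ▷ x ≫ (α_ _ _ _).hom ≫ x ◁ e = (λ_ x).hom ≫ (ρ_ x).inv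

namespace IsDuality

variable {x x' y y' : D} {c : 𝟙_ D ⟶ x ⊗ x'} {e : x' ⊗ x ⟶ 𝟙_ D}
  {c₂ : 𝟙_ D ⟶ y ⊗ y'} {e₂ : y' ⊗ y ⟶ 𝟙_ D}

/-- The exact pairing given by morphisms that satisfy the triangle identities. -/
abbrev exactPairing (h : IsDuality c e) : ExactPairing x x' where
  coevaluation' := c
  evaluation' := e
  coevaluation_evaluation' := h.left
  evaluation_coevaluation' := h.right

lemma left' (h : IsDuality c e) : x' ◁ c ⊗≫ e ▷ x' = ⊗𝟙.hom :=
  let := h.exactPairing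
  ExactPairing.coevaluation_evaluation'' x x'

lemma right' (h : IsDuality c e) : c ▷ x ⊗≫ x ◁ e = ⊗𝟙.hom :=
  let := h.exactPairing
  ExactPairing.evaluation_coevaluation'' x x'

/-- Up to coherence, the nested morphisms are the structure maps of the tensor product of two exact
pairings. -/
lemma nest (h : IsDuality c e) (h₂ : IsDuality c₂ e₂) :
    IsDuality (nestCoev c c₂) (nestEv e e₂) := by
  let := h.exactPairing
  let := h₂.exactPairing
  have hc : nestCoev c c₂ = η_ (x ⊗ y) (y' ⊗ x') := by
    rw [ExactPairing.tensor_coevaluation]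
    change nestCoev c c₂ = c ⊗≫ (x ◁ c₂) ▷ x' ⊗≫ 𝟙 _
    simp only [nestCoev]
    monoidal
  have he : nestEv e e₂ = ε_ (x ⊗ y) (y' ⊗ x') := by
    rw [ExactPairing.tensor_evaluation]
    change nestEv e e₂ = 𝟙 _ ⊗≫ y' ◁ (e ▷ y) ⊗≫ e₂
    simp only [nestEv]
    monoidal
  rw [hc, he]
  exact ⟨ExactPairing.coevaluation_evaluation _ _, ExactPairing.evaluation_coevaluation _ _⟩

lemma curry_left (h : IsDuality c e) {j m : D} (f : x' ⊗ j ⟶ m) :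
    x' ◁ ((λ_ j).inv ≫ c ▷ j ≫ (α_ x x' j).hom ≫ x ◁ f) ≫ (α_ x' x m).inv ≫
      e ▷ m ≫ (λ_ m).hom = f :=
  let := h.exactPairing
  (tensorLeftHomEquiv j x x' m).symm_apply_apply f

lemma uncurry_left (h : IsDuality c e) {j m : D} (f : m ⟶ x ⊗ j) :
    (λ_ m).inv ≫ c ▷ m ≫ (α_ x x' m).hom ≫
      x ◁ (x' ◁ f ≫ (α_ x' x j).inv ≫ e ▷ j ≫ (λ_ j).hom) = f :=
  let := h.exactPairing
  (tensorLeftHomEquiv m x x' j).apply_symm_apply f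

lemma curry_right (h : IsDuality c e) {i m : D} (f : i ⊗ x ⟶ m) :
    ((ρ_ i).inv ≫ i ◁ c ≫ (α_ i x x').inv ≫ f ▷ x') ▷ x ≫ (α_ m x' x).hom ≫
      m ◁ e ≫ (ρ_ m).hom = f :=
  let := h.exactPairing
  (tensorRightHomEquiv i x x' m).symm_apply_apply f

lemma uncurry_right (h : IsDuality c e) {i m : D} (f : m ⟶ i ⊗ x') :
    (ρ_ m).inv ≫ m ◁ c ≫ (α_ m x x').inv ≫
      (f ▷ x ≫ (α_ i x' x).hom ≫ i ◁ e ≫ (ρ_ i).hom) ▷ x' = f :=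
  let := h.exactPairing
  (tensorRightHomEquiv m x x' i).apply_symm_apply f

/-- A mate slides through the evaluation. -/
lemma mate_comp_ev (h : IsDuality c e) (e₂ : y' ⊗ y ⟶ 𝟙_ D) (f : x ⟶ y) :
    mate e₂ c f ▷ x ≫ e = y' ◁ f ≫ e₂ := by
  calc mate e₂ c f ▷ x ≫ e
      = 𝟙 _ ⊗≫ y' ◁ c ▷ x ⊗≫ y' ◁ f ▷ (x' ⊗ x) ⊗≫ (e₂ ▷ (x' ⊗ x) ≫ 𝟙_ D ◁ e) ⊗≫ 𝟙 _ := by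
        simp only [mate]; monoidal
    _ = 𝟙 _ ⊗≫ y' ◁ c ▷ x ⊗≫ y' ◁ (f ▷ (x' ⊗ x) ≫ y ◁ e) ⊗≫ e₂ := by
        rw [← whisker_exchange]; monoidal
    _ = 𝟙 _ ⊗≫ y' ◁ (c ▷ x ⊗≫ x ◁ e) ⊗≫ y' ◁ f ⊗≫ e₂ := by
        rw [← whisker_exchange]; monoidal
    _ = _ := by rw [h.right']; monoidal

/-- A mate slides through the coevaluation. -/
lemma coev_comp_mate (h₂ : IsDuality c₂ e₂) (c : 𝟙_ D ⟶ x ⊗ x') (f : x ⟶ y) :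
    c₂ ≫ y ◁ mate e₂ c f = c ≫ f ▷ x' := by
  calc c₂ ≫ y ◁ mate e₂ c f
      = 𝟙 _ ⊗≫ (c₂ ▷ 𝟙_ D ≫ (y ⊗ y') ◁ c) ⊗≫ y ◁ y' ◁ f ▷ x' ⊗≫ y ◁ e₂ ▷ x' ⊗≫ 𝟙 _ := by
        simp only [mate]; monoidal
    _ = c ⊗≫ (c₂ ▷ x ≫ (y ⊗ y') ◁ f) ▷ x' ⊗≫ y ◁ e₂ ▷ x' ⊗≫ 𝟙 _ := by
        rw [← whisker_exchange]; monoidal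
    _ = c ⊗≫ f ▷ x' ⊗≫ (c₂ ▷ y ⊗≫ y ◁ e₂) ▷ x' ⊗≫ 𝟙 _ := by
        rw [← whisker_exchange]; monoidal
    _ = _ := by rw [h₂.right']; monoidal

end IsDuality

/-- The left dual of a morphism `f : x ⟶ y` with respect to `e : y ⊗ y' ⟶ 1` and
`c : 1 ⟶ x' ⊗ x`. -/
def leftMate {x x' y y' : D} (e : y ⊗ y' ⟶ 𝟙_ D) (c : 𝟙_ D ⟶ x' ⊗ x) (f : x ⟶ y) :
    y' ⟶ x' :=
  (λ_ y').inv ≫ c ▷ y' ≫ (x' ◁ f) ▷ y' ≫ (α_ x' y y').hom ≫ x' ◁ e ≫ (ρ_ x').hom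

section

variable {x x' y y' : D} {c : 𝟙_ D ⟶ x' ⊗ x} {e : x ⊗ x' ⟶ 𝟙_ D}
  {c₂ : 𝟙_ D ⟶ y' ⊗ y} {e₂ : y ⊗ y' ⟶ 𝟙_ D}

/-- Dualizing to the left and then to the right produces one zigzag on each of x and y, and the
triangle identities straighten both. -/
lemma mate_leftMate (h : IsDuality c e) (h₂ : IsDuality c₂ e₂) (f : x ⟶ y) :
    mate e c₂ (leftMate e₂ c f) = f := by
  calc mate e c₂ (leftMate e₂ c f)
      = 𝟙 _ ⊗≫ x ◁ c₂ ⊗≫ x ◁ (c ▷ (y' ⊗ y) ≫ (x' ⊗ x) ◁ 𝟙 _) ⊗≫ x ◁ x' ◁ f ▷ (y' ⊗ y) ⊗≫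
          x ◁ x' ◁ e₂ ▷ y ⊗≫ e ▷ y ⊗≫ 𝟙 _ := by
        simp only [mate, leftMate]; monoidal
    _ = 𝟙 _ ⊗≫ x ◁ (𝟙_ D ◁ c₂ ≫ c ▷ (y' ⊗ y)) ⊗≫ (((x ⊗ x') ◁ (f ▷ y' ≫ e₂)) ≫ e ▷ 𝟙_ D) ▷ y
          ⊗≫ 𝟙 _ := by
        monoidal
    _ = 𝟙 _ ⊗≫ (x ◁ c ⊗≫ e ▷ x) ⊗≫ (x ◁ c₂ ≫ f ▷ (y' ⊗ y)) ⊗≫ e₂ ▷ y ⊗≫ 𝟙 _ := by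
        rw [whisker_exchange, whisker_exchange]
        calc _ = 𝟙 _ ⊗≫ x ◁ c ⊗≫ (((x ⊗ x') ◁ (x ◁ c₂)) ≫ e ▷ (x ⊗ (y' ⊗ y))) ⊗≫
                  (f ▷ y' ≫ e₂) ▷ y ⊗≫ 𝟙 _ := by monoidal
          _ = _ := by rw [whisker_exchange]; monoidal
    _ = 𝟙 _ ⊗≫ f ⊗≫ (y ◁ c₂ ⊗≫ e₂ ▷ y) ⊗≫ 𝟙 _ := by
        rw [h.left', whisker_exchange]; monoidal
    _ = f := by rw [h₂.left']; monoidal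

lemma leftMate_mate (h : IsDuality c e) (h₂ : IsDuality c₂ e₂) (f : y' ⟶ x') :
    leftMate e₂ c (mate e c₂ f) = f := by
  calc leftMate e₂ c (mate e c₂ f)
      = 𝟙 _ ⊗≫ (c ≫ x' ◁ (mate e c₂ f)) ▷ y' ⊗≫ x' ◁ e₂ ⊗≫ 𝟙 _ := by
        simp only [leftMate]; monoidal
    _ = 𝟙 _ ⊗≫ c₂ ▷ y' ⊗≫ (f ▷ (y ⊗ y') ≫ x' ◁ e₂) ⊗≫ 𝟙 _ := by
        rw [h.coev_comp_mate]; monoidal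
    _ = 𝟙 _ ⊗≫ (c₂ ▷ y' ⊗≫ y' ◁ e₂) ⊗≫ f := by
        rw [← whisker_exchange]; monoidal
    _ = f := by rw [h₂.right']; monoidal

end

/-- The partial dual that creates a strand on the left and bends the first source leg. -/
def bendLeft {x x' : D} (c : 𝟙_ D ⟶ x' ⊗ x) {j m : D} (f : x ⊗ j ⟶ m) : j ⟶ x' ⊗ m :=
  (λ_ j).inv ≫ c ▷ j ≫ (α_ x' x j).hom ≫ x' ◁ f

/-- The partial dual that bends the first target leg. -/
def unbendLeft {x x' : D} (e : x' ⊗ x ⟶ 𝟙_ D) {j m : D} (f : m ⟶ x ⊗ j) : x' ⊗ m ⟶ j :=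
  x' ◁ f ≫ (α_ x' x j).inv ≫ e ▷ j ≫ (λ_ j).hom

/-- The partial dual that bends the second source leg. -/
def bendRight {x x' : D} (c : 𝟙_ D ⟶ x ⊗ x') {i m : D} (f : i ⊗ x ⟶ m) : i ⟶ m ⊗ x' :=
  (ρ_ i).inv ≫ i ◁ c ≫ (α_ i x x').inv ≫ f ▷ x'

/-- The partial dual that bends the second target leg. -/
def unbendRight {x x' : D} (e : x ⊗ x' ⟶ 𝟙_ D) {i m : D} (f : m ⟶ i ⊗ x) : m ⊗ x' ⟶ i :=
  f ▷ x' ≫ (α_ i x x').hom ≫ i ◁ e ≫ (ρ_ i).hom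

variable {i i' j j' m m' : D}

/-- Rotating right, left, right gives the right dual. -/
lemma bendRight_unbendLeft_bendRight (ci : 𝟙_ D ⟶ i ⊗ i') (cj : 𝟙_ D ⟶ j ⊗ j')
    (em : m' ⊗ m ⟶ 𝟙_ D) (f : i ⊗ j ⟶ m) :
    bendRight ci (unbendLeft em (bendRight cj f)) = mate em (nestCoev ci cj) f := by
  simp only [bendRight, unbendLeft, mate, nestCoev]
  monoidal

/-- Rotating left, right, left gives the left dual. -/
lemma bendLeft_unbendRight_bendLeft (ci : 𝟙_ D ⟶ i' ⊗ i) (cj : 𝟙_ D ⟶ j' ⊗ j)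
    (em : m ⊗ m' ⟶ 𝟙_ D) (f : i ⊗ j ⟶ m) :
    bendLeft cj (unbendRight em (bendLeft ci f)) = leftMate em (nestCoev cj ci) f := by
  simp only [bendLeft, unbendRight, leftMate, nestCoev]
  monoidal

/-- Bending a common strand to the other side. -/
lemma bend_middle {c : 𝟙_ D ⟶ j' ⊗ j} {e : j ⊗ j' ⟶ 𝟙_ D} (h : IsDuality c e) {q r p : D}
    (x₄ : q ⟶ i ⊗ j) (x₁ : j ⊗ r ⟶ p) :
    q ◁ bendLeft c x₁ ≫ (α_ q j' p).inv ≫ unbendRight e x₄ ▷ p =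
      x₄ ▷ r ≫ (α_ i j r).hom ≫ i ◁ x₁ := by
  calc q ◁ bendLeft c x₁ ≫ (α_ q j' p).inv ≫ unbendRight e x₄ ▷ p
      = 𝟙 _ ⊗≫ q ◁ c ▷ r ⊗≫ ((q ◁ (j' ◁ x₁)) ≫ x₄ ▷ (j' ⊗ p)) ⊗≫ i ◁ e ▷ p ⊗≫ 𝟙 _ := by
        simp only [bendLeft, unbendRight]; monoidal
    _ = 𝟙 _ ⊗≫ (q ◁ c ≫ x₄ ▷ (j' ⊗ j)) ▷ r ⊗≫ i ◁ ((j ⊗ j') ◁ x₁ ≫ e ▷ p) ⊗≫ 𝟙 _ := by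
        rw [whisker_exchange]; monoidal
    _ = 𝟙 _ ⊗≫ x₄ ▷ r ⊗≫ i ◁ (j ◁ c ⊗≫ e ▷ j) ▷ r ⊗≫ i ◁ x₁ := by
        rw [whisker_exchange, whisker_exchange]; monoidal
    _ = _ := by rw [h.left']; monoidal

/-- The two ways of closing up an endomorphism of `i ⊗ j` on the outer sides agree. -/
lemma trace_left_right (ci : 𝟙_ D ⟶ i' ⊗ i) (ei : i' ⊗ i ⟶ 𝟙_ D) (cj : 𝟙_ D ⟶ j ⊗ j')
    (ej : j ⊗ j' ⟶ 𝟙_ D) (f : i ⊗ j ⟶ m) (g : m ⟶ i ⊗ j) :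
    cj ≫ (bendLeft ci f ≫ unbendLeft ei g) ▷ j' ≫ ej =
      ci ≫ i' ◁ (bendRight cj f ≫ unbendRight ej g) ≫ ei := by
  calc cj ≫ (bendLeft ci f ≫ unbendLeft ei g) ▷ j' ≫ ej
      = 𝟙 _ ⊗≫ (𝟙_ D ◁ cj ≫ ci ▷ (j ⊗ j')) ⊗≫ i' ◁ (f ≫ g) ▷ j' ⊗≫
          (ei ▷ (j ⊗ j') ≫ 𝟙_ D ◁ ej) ⊗≫ 𝟙 _ := by
        simp only [bendLeft, unbendLeft]; monoidal
    _ = ci ≫ i' ◁ (bendRight cj f ≫ unbendRight ej g) ≫ ei := by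
        rw [whisker_exchange, ← whisker_exchange ei]
        simp only [bendRight, unbendRight]
        monoidal

variable {ci : 𝟙_ D ⟶ i ⊗ i'} {ei : i' ⊗ i ⟶ 𝟙_ D} {ci' : 𝟙_ D ⟶ i' ⊗ i} {ei' : i ⊗ i' ⟶ 𝟙_ D}
  {cj : 𝟙_ D ⟶ j ⊗ j'} {ej : j' ⊗ j ⟶ 𝟙_ D} {cj' : 𝟙_ D ⟶ j' ⊗ j} {ej' : j ⊗ j' ⟶ 𝟙_ D}
  {cm : 𝟙_ D ⟶ m ⊗ m'} {em : m' ⊗ m ⟶ 𝟙_ D} {cm' : 𝟙_ D ⟶ m' ⊗ m} {em' : m ⊗ m' ⟶ 𝟙_ D}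

/-- Cyclicity of the left trace up to the double dual. -/
lemma left_trace_cyclic (hm : IsDuality cm em) (hm' : IsDuality cm' em') (f : i ⊗ j ⟶ m)
    (g : m ⟶ i ⊗ j) :
    ci ≫ (bendRight cj f ≫ unbendRight ej' g) ▷ i' ≫ ei' =
      cm ≫ (g ≫ mate (nestEv ej' ei') cm' (mate em (nestCoev ci cj) f)) ▷ m' ≫ em' := by
  calc ci ≫ (bendRight cj f ≫ unbendRight ej' g) ▷ i' ≫ ei'
      = (nestCoev ci cj ≫ f ▷ (j' ⊗ i')) ≫ g ▷ (j' ⊗ i') ≫ nestEv ej' ei' := by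
        simp only [bendRight, unbendRight, nestCoev, nestEv]; monoidal
    _ = cm ≫ g ▷ m' ≫ (i ⊗ j) ◁ mate em (nestCoev ci cj) f ≫ nestEv ej' ei' := by
        rw [← hm.coev_comp_mate, Category.assoc, whisker_exchange_assoc]
    _ = _ := by rw [← hm'.mate_comp_ev, comp_whiskerRight, Category.assoc]

/-- Cyclicity of the right trace up to the double dual. -/
lemma right_trace_cyclic (hi : IsDuality ci ei) (hj : IsDuality cj ej) (hi' : IsDuality ci' ei')
    (hj' : IsDuality cj' ej') (f : i ⊗ j ⟶ m) (g : m ⟶ i ⊗ j) :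
    cj' ≫ j' ◁ (bendLeft ci' (mate (nestEv ej' ei') cm' (mate em (nestCoev ci cj) f)) ≫
        unbendLeft ei g) ≫ ej =
      cm' ≫ m' ◁ (g ≫ f) ≫ em := by
  set d := mate em (nestCoev ci cj) f with hd
  calc cj' ≫ j' ◁ (bendLeft ci' (mate (nestEv ej' ei') cm' d) ≫ unbendLeft ei g) ≫ ej
      = (nestCoev cj' ci' ≫ (j' ⊗ i') ◁ mate (nestEv ej' ei') cm' d) ≫ (j' ⊗ i') ◁ g ≫
          nestEv ei ej := by
        simp only [bendLeft, unbendLeft, nestCoev, nestEv]; monoidal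
    _ = cm' ≫ m' ◁ g ≫ d ▷ (i ⊗ j) ≫ nestEv ei ej := by
        rw [(hj'.nest hi').coev_comp_mate, Category.assoc, whisker_exchange_assoc]
    _ = _ := by rw [hd, (hi.nest hj).mate_comp_ev, whiskerLeft_comp, Category.assoc]

end Duality

end

section

/-! ### Rigidity of a veined fusion category -/

namespace PreFusionCategory

variable {k : Type w} [Field k] {D : Type u} [Category.{v} D] [Preadditive D]
  [Linear k D]

lemma _root_.Veined.biorthogonalBasis_repr {V ι : Type*} [AddCommGroup V] [Module k V] [Fintype ι]
    (e : ι → V) (φ : ι → V →ₗ[k] k) (h₁ : ∀ x y, φ x (e y) = if x = y then 1 else 0)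
    (h₂ : ∀ f, ∑ x, φ x f • e x = f) (f : V) (x : ι) :
    (biorthogonalBasis e φ h₁ h₂).repr f x = φ x f := by
  have h : (biorthogonalBasis e φ h₁ h₂).coord x = φ x := by
    refine (biorthogonalBasis e φ h₁ h₂).ext fun y => ?_
    rw [Module.Basis.coord_apply, Module.Basis.repr_self, biorthogonalBasis, Module.Basis.mk_apply,
      h₁, Finsupp.single_apply]
    simp [eq_comm]
  rw [← h]
  rfl

variable [MonoidalCategory D] [MonoidalPreadditive D] [MonoidalLinear k D]
  {C : PreFusionCategory k D}

lemma eq_bar {i i' : C.S} (h : ∀ j : C.S,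
    Module.rank k ((j : D) ⊗ (i' : D) ⟶ 𝟙_ D) = (if i = j then 1 else 0) ∧
    Module.rank k ((i' : D) ⊗ (j : D) ⟶ 𝟙_ D) = (if i = j then 1 else 0)) : C.bar i = i' :=
  (C.exists_bar i).unique (C.bar_spec i) h

lemma bar_injective : Function.Injective C.bar := by
  intro i j h
  by_contra hne
  have h₁ := (C.bar_spec i i).1
  have h₂ := (C.bar_spec j i).1
  rw [h, h₂, if_neg (Ne.symm hne), if_pos rfl] at h₁
  exact zero_ne_one h₁

/-- The bar is injective on a finite set, so every test object has the form j̄; on such objects the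
left and right conditions defining the bar turn into each other. -/
lemma bar_bar (i : C.S) : C.bar (C.bar i) = i := by
  refine eq_bar fun j => ?_
  obtain ⟨j, rfl⟩ := Finite.surjective_of_injective bar_injective j
  rw [(C.bar_spec j i).1, (C.bar_spec j i).2]
  by_cases h : i = j
  · simp [h]
  · simp [h, Ne.symm h, bar_injective.eq_iff]

lemma bar_one : C.bar C.one = C.one := by
  refine eq_bar fun j => ?_
  have h := C.rank_hom j C.one
  have e₁ : ((j : D) ⊗ 𝟙_ D ⟶ 𝟙_ D) ≃ₗ[k] ((j : D) ⟶ 𝟙_ D) :=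
    Linear.homCongr k (ρ_ (j : D)) (Iso.refl _)
  have e₂ : (𝟙_ D ⊗ (j : D) ⟶ 𝟙_ D) ≃ₗ[k] ((j : D) ⟶ 𝟙_ D) :=
    Linear.homCongr k (λ_ (j : D)) (Iso.refl _)
  refine ⟨e₁.rank_eq.trans ?_, e₂.rank_eq.trans ?_⟩ <;>
  · refine h.trans ?_
    simp [eq_comm]

/-- The pairing between `Hom(m, x)` and `Hom(x, m)` is nondegenerate on the right. -/
lemma hom_ext_left {x : D} {m : C.S} {f g : x ⟶ (m : D)}
    (h : ∀ a : (m : D) ⟶ x, C.scalar m (a ≫ f) = C.scalar m (a ≫ g)) : f = g :=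
  (LinearMap.IsPerfPair.bijective_right (C.pairing x m)).1 (LinearMap.ext h)

namespace Framing

variable (b : C.Framing)

lemma leftBasis_repr (i j r l q : C.S) (γ : Fin (C.N i j q)) (δ : Fin (C.N q r l))
    (f : ((i : D) ⊗ (j : D)) ⊗ (r : D) ⟶ (l : D)) :
    (b.leftBasis i j r l).repr f ⟨q, γ, δ⟩ =
      C.scalar l (b.dbasis q r l δ ≫ b.dbasis i j q γ ▷ (r : D) ≫ f) := by
  rw [leftBasis, biorthogonalBasis_repr, ← Category.assoc]
  rfl

lemma rightBasis_repr (i j r l p : C.S) (α : Fin (C.N i p l)) (β : Fin (C.N j r p))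
    (f : (i : D) ⊗ ((j : D) ⊗ (r : D)) ⟶ (l : D)) :
    (b.rightBasis i j r l).repr f ⟨p, α, β⟩ =
      C.scalar l (b.dbasis i p l α ≫ (i : D) ◁ b.dbasis j r p β ≫ f) := by
  rw [rightBasis, biorthogonalBasis_repr, ← Category.assoc]
  rfl

lemma dbasis_left_unit (i : C.S) (α : Fin (C.N C.one i i)) :
    b.dbasis C.one i i α = (λ_ (i : D)).inv := by
  have h := dualBasis_comp (b.basis C.one i i) α α
  rw [if_pos rfl, b.left_unit] at h
  rw [← cancel_mono (λ_ (i : D)).hom, Iso.inv_hom_id]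
  exact h

/-- This exhibits F_i as the scalar of the zigzag built from the unnormalized cup and cap, the
quantity that the factor F_i in the cap has to cancel. -/
lemma F₀_eq (i : C.S) :
    b.F₀ i = C.scalar i ((λ_ (i : D)).inv ≫ b.coev i ▷ (i : D) ≫
      (α_ (i : D) (C.bar i : D) (i : D)).hom ≫ (i : D) ◁ b.ev' i ≫ (ρ_ (i : D)).hom) := by
  rw [F₀, sixJ, leftBasis_repr, dbasis_left_unit, b.right_unit]
  rfl

lemma coev_comp_ev (i : C.S) : b.coev i ≫ b.ev i = 𝟙 _ := by
  have h := dualBasis_comp (b.basis i (C.bar i) C.one) (Fin.cast (C.N_eval i).symm 0)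
    (Fin.cast (C.N_eval i).symm 0)
  rwa [if_pos rfl] at h

lemma coev'_comp_ev' (i : C.S) : b.coev' i ≫ b.ev' i = 𝟙 _ := by
  have h := dualBasis_comp (b.basis (C.bar i) i C.one) (Fin.cast (C.N_eval' i).symm 0)
    (Fin.cast (C.N_eval' i).symm 0)
  rwa [if_pos rfl] at h

lemma ev'_ne_zero (i : C.S) : b.ev' i ≠ 0 := by
  intro h
  have h₁ := b.coev'_comp_ev' i
  rw [h, comp_zero] at h₁
  exact C.id_ne_zero C.one h₁.symm

variable {b}

/-- One triangle identity is the normalization by F_i. The other needs no second normalization: the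
opposite zigzag is a scalar endomorphism of ī, and by the first identity it is absorbed by the
nonzero evaluation, so it is 1. -/
lemma cup_cap'_isDuality (hb : b.IsVeined) (μ : C.S → kˣ) (i : C.S) : IsDuality (b.cup μ i) (b.cap' μ i) := by
  have hF : b.F₀ i ≠ 0 := (hb i).ne_zero
  have hright : b.cup μ i ▷ (i : D) ≫ (α_ _ _ _).hom ≫ (i : D) ◁ b.cap' μ i =
      (λ_ (i : D)).hom ≫ (ρ_ (i : D)).inv := by
    rw [← cancel_epi (λ_ (i : D)).inv, ← cancel_mono (ρ_ (i : D)).hom]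
    simp only [Category.assoc, Iso.inv_hom_id_assoc, Iso.inv_hom_id]
    rw [← C.scalar_smul_id i ((λ_ (i : D)).inv ≫ _)]
    simp only [cup, cap', MonoidalLinear.smul_whiskerRight, MonoidalLinear.whiskerLeft_smul,
      Linear.smul_comp, Linear.comp_smul, map_smul, ← F₀_eq, smul_eq_mul]
    rw [← one_smul k (𝟙 (i : D))]
    congr 1
    · have := (μ (C.bar i)).ne_zero
      field_simp
    · simp
  refine ⟨?_, hright⟩
  have hcap : b.cap' μ i ≠ 0 := by
    have := (μ (C.bar i)).ne_zero
    simp [cap', hF, b.ev'_ne_zero]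
  set c := b.cup μ i
  set e := b.cap' μ i
  set s : (C.bar i : D) ⟶ (C.bar i : D) :=
    (ρ_ _).inv ≫ (C.bar i : D) ◁ c ≫ (α_ _ _ _).inv ≫ e ▷ (C.bar i : D) ≫ (λ_ _).hom with hs
  have h₁ : s ▷ (i : D) ≫ e = e := by
    calc s ▷ (i : D) ≫ e
        = 𝟙 _ ⊗≫ (C.bar i : D) ◁ c ▷ (i : D) ⊗≫ (e ▷ ((C.bar i : D) ⊗ (i : D)) ≫ 𝟙_ D ◁ e) ⊗≫
            𝟙 _ := by
          rw [hs]; monoidal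
      _ = 𝟙 _ ⊗≫ (C.bar i : D) ◁ (c ▷ (i : D) ≫ (α_ _ _ _).hom ≫ (i : D) ◁ e) ⊗≫ e := by
          rw [← whisker_exchange]; monoidal
      _ = e := by rw [hright]; monoidal
  have h₂ : s = 𝟙 _ := by
    rw [← C.scalar_smul_id _ s] at h₁ ⊢
    rw [MonoidalLinear.smul_whiskerRight, Linear.smul_comp, id_whiskerRight, Category.id_comp] at h₁
    have h₃ : (C.scalar _ s - 1) • e = 0 := by rw [sub_smul, h₁, one_smul, sub_self]
    rw [sub_eq_zero.1 ((smul_eq_zero.1 h₃).resolve_right hcap), one_smul]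
  rw [← cancel_epi (ρ_ (C.bar i : D)).inv, ← cancel_mono (λ_ (C.bar i : D)).hom]
  simpa [hs] using h₂

/-- This is the preceding duality for ī. Since the double bar is i only propositionally, the outer
label is generalized before it is identified with i; the comparisons of cups and caps below use the
same device. -/
lemma cup'_cap_isDuality (hb : b.IsVeined) (μ : C.S → kˣ) (i : C.S) : IsDuality (b.cup' μ i) (b.cap μ i) := by
  have key : ∀ (i' : C.S) (_ : i' = i) (h₁ : C.N (C.bar i) i' C.one = 1)
      (h₂ : C.N i' (C.bar i) C.one = 1),
      IsDuality (x := (C.bar i : D)) (x' := (i' : D))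
        ((μ i' : k) • b.dbasis (C.bar i) i' C.one (Fin.cast h₁.symm 0))
        (((μ i' : k) * b.F₀ (C.bar i))⁻¹ • b.basis i' (C.bar i) C.one (Fin.cast h₂.symm 0)) →
      IsDuality (b.cup' μ i) (b.cap μ i) := by
    rintro _ rfl _ _ h
    exact h
  exact key _ (bar_bar i) (C.N_eval _) (C.N_eval' _) (cup_cap'_isDuality hb μ (C.bar i))

variable (b) (μ : C.S → kˣ)

lemma cup'_bar_heq (i : C.S) : HEq (b.cup' μ (C.bar i)) (b.cup μ i) := by
  have key : ∀ (i' : C.S) (_ : i' = i) (h : C.N i' (C.bar i) C.one = 1),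
      HEq ((μ (C.bar i) : k) • b.dbasis i' (C.bar i) C.one (Fin.cast h.symm 0)) (b.cup μ i) := by
    rintro _ rfl _; rfl
  exact key _ (bar_bar i) (C.N_eval' _)

lemma cup_bar_heq (i : C.S) : HEq (b.cup μ (C.bar i)) (b.cup' μ i) := by
  have key : ∀ (i' : C.S) (_ : i' = i) (h : C.N (C.bar i) i' C.one = 1),
      HEq ((μ i' : k) • b.dbasis (C.bar i) i' C.one (Fin.cast h.symm 0)) (b.cup' μ i) := by
    rintro _ rfl _; rfl
  exact key _ (bar_bar i) (C.N_eval _)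

lemma cap'_bar_heq (i : C.S) : HEq (b.cap' μ (C.bar i)) (b.cap μ i) := by
  have key : ∀ (i' : C.S) (_ : i' = i) (h : C.N i' (C.bar i) C.one = 1),
      HEq (((μ i' : k) * b.F₀ (C.bar i))⁻¹ • b.basis i' (C.bar i) C.one (Fin.cast h.symm 0))
        (b.cap μ i) := by
    rintro _ rfl _; rfl
  exact key _ (bar_bar i) (C.N_eval' _)

lemma cap_bar_heq (i : C.S) : HEq (b.cap μ (C.bar i)) (b.cap' μ i) := by
  have key : ∀ (i' : C.S) (_ : i' = i) (h : C.N (C.bar i) i' C.one = 1),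
      HEq (((μ (C.bar i) : k) * b.F₀ i')⁻¹ • b.basis (C.bar i) i' C.one (Fin.cast h.symm 0))
        (b.cap' μ i) := by
    rintro _ rfl _; rfl
  exact key _ (bar_bar i) (C.N_eval _)

/-- Two-sidedness of dimensions thereby becomes d_i = d_ī, the condition under which the convention
fixes the root. -/
lemma dimL_bar (i : C.S) : b.dimL μ (C.bar i) = b.dimR μ i := by
  have key : ∀ (i' : C.S) (_ : i' = i) (c : 𝟙_ D ⟶ (C.bar i : D) ⊗ (i' : D))
      (e : (C.bar i : D) ⊗ (i' : D) ⟶ 𝟙_ D), HEq c (b.cup' μ i) → HEq e (b.cap' μ i) →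
      C.scalar C.one (c ≫ e) = b.dimR μ i := by
    rintro _ rfl _ _ ⟨⟩ ⟨⟩; rfl
  exact key _ (bar_bar i) _ _ (b.cup_bar_heq μ i) (b.cap_bar_heq μ i)

variable {b}

lemma dimL_ne_zero (hb : b.IsVeined) (i : C.S) : b.dimL μ i ≠ 0 := by
  have h₁ := (μ (C.bar i)).ne_zero
  have h₂ := (μ i).ne_zero
  have h₃ := (hb (C.bar i)).ne_zero
  have h₄ : b.dimL μ i = (μ (C.bar i) : k) * ((μ i : k) * b.F₀ (C.bar i))⁻¹ := by
    simp only [dimL, cup, cap, Linear.smul_comp, Linear.comp_smul, coev_comp_ev, map_smul,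
      smul_eq_mul]
    rw [show C.scalar C.one (𝟙 (𝟙_ D)) = 1 from C.scalar_id C.one, mul_one, mul_comm]
  rw [h₄]
  exact mul_ne_zero h₁ (inv_ne_zero (mul_ne_zero h₂ h₃))

end Framing
end PreFusionCategory

end

section

/-! ### Partial traces, rotations and the double dual -/

namespace PreFusionCategory

variable {k : Type w} [Field k] {D : Type u} [Category.{v} D] [Preadditive D]
  [Linear k D] [MonoidalCategory D] [MonoidalPreadditive D] [MonoidalLinear k D]
  {C : PreFusionCategory k D}

namespace Framing

variable {b : C.Framing} (μ : C.S → kˣ)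

lemma scalar_left_trace (i : C.S) (f : (i : D) ⟶ (i : D)) :
    C.scalar C.one (b.cup μ i ≫ f ▷ (C.bar i : D) ≫ b.cap μ i) =
      b.dimL μ i * C.scalar i f := by
  conv_lhs => rw [← C.scalar_smul_id i f]
  simp only [MonoidalLinear.smul_whiskerRight, id_whiskerRight, Linear.smul_comp,
    Linear.comp_smul, Category.id_comp, map_smul, smul_eq_mul, dimL]
  ring

lemma scalar_right_trace (i : C.S) (f : (i : D) ⟶ (i : D)) :
    C.scalar C.one (b.cup' μ i ≫ (C.bar i : D) ◁ f ≫ b.cap' μ i) =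
      b.dimR μ i * C.scalar i f := by
  conv_lhs => rw [← C.scalar_smul_id i f]
  simp only [MonoidalLinear.whiskerLeft_smul, whiskerLeft_id, Linear.smul_comp,
    Linear.comp_smul, Category.id_comp, map_smul, smul_eq_mul, dimR]
  ring

/-- Both sides are the same closed diagram: strand i is closed on the left, strand j on the right,
and only the order of closing differs. -/
lemma scalar_partial_traces {i j m : C.S} (f : C.Hm i j m) (g : C.Hd i j m) :
    b.dimL μ j * C.scalar j (b.Lm μ i j m f ≫ b.Ld μ i j m g) =
      b.dimR μ i * C.scalar i (b.Rm μ i j m f ≫ b.Rd μ i j m g) := by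
  rw [← scalar_left_trace, ← scalar_right_trace]
  exact congrArg (C.scalar C.one)
    (trace_left_right (b.cup' μ i) (b.cap' μ i) (b.cup μ j) (b.cap μ j) f g)

/-- Closing the remaining strand i yields the left trace over i ⊗ j of f followed by g; carrying f
around the loop leaves the left trace over m of g followed by the double dual of f. -/
lemma scalar_right_partial_trace (hb : b.IsVeined) {i j m : C.S} (f : C.Hm i j m)
    (g : C.Hd i j m) :
    b.dimL μ i * C.scalar i (b.Rm μ i j m f ≫ b.Rd μ i j m g) =
      b.dimL μ m * C.scalar m (g ≫ b.doubleDual μ f) := by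
  rw [← scalar_left_trace, ← scalar_left_trace]
  exact congrArg (C.scalar C.one) (left_trace_cyclic (ci := b.cup μ i) (ei' := b.cap μ i)
    (cj := b.cup μ j) (ej' := b.cap μ j) (cup_cap'_isDuality hb μ m)
    (cup'_cap_isDuality hb μ m) f g)

/-- Mirror image: carrying a morphism around the right trace undoes the double dual, which is why it
stands on the other side of the equation here. -/
lemma scalar_left_partial_trace (hb : b.IsVeined) {i j m : C.S} (f : C.Hm i j m)
    (g : C.Hd i j m) :
    b.dimR μ j * C.scalar j (b.Lm μ i j m (b.doubleDual μ f) ≫ b.Ld μ i j m g) =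
      b.dimR μ m * C.scalar m (g ≫ f) := by
  rw [← scalar_right_trace, ← scalar_right_trace]
  exact congrArg (C.scalar C.one) (right_trace_cyclic (cm' := b.cup' μ m)
    (em := b.cap' μ m) (cup_cap'_isDuality hb μ i)
    (cup_cap'_isDuality hb μ j) (cup'_cap_isDuality hb μ i) (cup'_cap_isDuality hb μ j) f g)

lemma doubleDual_sub {i j m : C.S} (f g : C.Hm i j m) :
    b.doubleDual μ (f - g) = b.doubleDual μ f - b.doubleDual μ g := by
  have h : ∀ f g : C.Hm i j m,
      b.doubleDual μ (f + g) = b.doubleDual μ f + b.doubleDual μ g := fun f g => by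
    simp [doubleDual, rdual, mate]
  rw [eq_sub_iff_add_eq, ← h, sub_add_cancel]

/-- If the left and right dimensions agree, the quadruple dual is trivial. -/
lemma doubleDual_doubleDual (hb : b.IsVeined) (hd : ∀ i, b.dimL μ i = b.dimR μ i) {i j m : C.S}
    (f : C.Hm i j m) : b.doubleDual μ (b.doubleDual μ f) = f := by
  refine hom_ext_left fun g => ?_
  -- Applied to the double dual of f, the left partial trace gives d_m times the pairing of g with
  -- f, and the right one d_m times its pairing with the quadruple dual of f.
  have h₁ := scalar_partial_traces (b := b) μ (b.doubleDual μ f) g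
  rw [hd j, scalar_left_partial_trace μ hb, ← hd i, scalar_right_partial_trace μ hb, ← hd m] at h₁
  exact (mul_left_cancel₀ (dimL_ne_zero μ hb m) h₁).symm

lemma bend_rot_left {i j m : C.S} (f : C.Hm i j m) :
    b.Lm μ j (C.bar m) (C.bar i) (b.Rd μ (C.bar i) m j (b.Lm μ i j m f)) =
      leftMate (b.cap μ m) (nestCoev (b.cup' μ j) (b.cup' μ i)) f :=
  bendLeft_unbendRight_bendLeft (b.cup' μ i) (b.cup' μ j) (b.cap μ m) f

lemma bend_rot_right {i j m : C.S} (f : C.Hm i j m) :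
    b.Rm μ (C.bar m) i (C.bar j) (b.Ld μ m (C.bar j) i (b.Rm μ i j m f)) = b.rdual μ f :=
  bendRight_unbendLeft_bendRight (b.cup μ i) (b.cup μ j) (b.cap' μ m) f

/-- The double dual is trivial on `f` iff its two rotations by a full turn agree. -/
lemma doubleDual_eq_iff (hb : b.IsVeined) {i j m : C.S} (f : C.Hm i j m) :
    b.doubleDual μ f = f ↔
      b.Lm μ j (C.bar m) (C.bar i) (b.Rd μ (C.bar i) m j (b.Lm μ i j m f)) =
        b.Rm μ (C.bar m) i (C.bar j) (b.Ld μ m (C.bar j) i (b.Rm μ i j m f)) := by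
  have h₁ := (cup'_cap_isDuality hb μ j).nest (cup'_cap_isDuality hb μ i)
  have h₂ := cup'_cap_isDuality hb μ m
  -- The two rotations are now the left and the right dual of f. Left and right dualization are
  -- mutually inverse, so the duals agree exactly when dualizing twice to the right returns f.
  rw [bend_rot_left, bend_rot_right]
  constructor
  · intro h
    conv_lhs => rw [← h]
    exact leftMate_mate h₁ h₂ _
  · intro h
    rw [doubleDual, ← h]
    exact mate_leftMate h₁ h₂ f

/-- This is a triangle identity; heterogeneous equality is needed because bending twice lands in a
Hom space labeled by the double bar of i. -/
lemma Ld_Lm_heq (hb : b.IsVeined) {i j m : C.S} (f : C.Hm i j m) :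
    HEq (b.Ld μ (C.bar i) m j (b.Lm μ i j m f)) f := by
  have key : ∀ (i' : C.S) (_ : i' = i) (e : (i' : D) ⊗ (C.bar i : D) ⟶ 𝟙_ D),
      HEq e (b.cap μ i) → HEq (unbendLeft e (b.Lm μ i j m f)) f := by
    rintro i rfl _ ⟨⟩
    exact heq_of_eq ((cup'_cap_isDuality hb μ i).curry_left f)
  exact key _ (bar_bar i) _ (b.cap'_bar_heq μ i)

lemma Lm_Ld_heq (hb : b.IsVeined) {i j m : C.S} (f : C.Hd i j m) :
    HEq (b.Lm μ (C.bar i) m j (b.Ld μ i j m f)) f := by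
  have key : ∀ (i' : C.S) (_ : i' = i) (c : 𝟙_ D ⟶ (i' : D) ⊗ (C.bar i : D)),
      HEq c (b.cup μ i) → HEq (bendLeft c (b.Ld μ i j m f)) f := by
    rintro i rfl _ ⟨⟩
    exact heq_of_eq ((cup_cap'_isDuality hb μ i).uncurry_left f)
  exact key _ (bar_bar i) _ (b.cup'_bar_heq μ i)

lemma Rd_Rm_heq (hb : b.IsVeined) {i j m : C.S} (f : C.Hm i j m) :
    HEq (b.Rd μ m (C.bar j) i (b.Rm μ i j m f)) f := by
  have key : ∀ (j' : C.S) (_ : j' = j) (e : (C.bar j : D) ⊗ (j' : D) ⟶ 𝟙_ D),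
      HEq e (b.cap' μ j) → HEq (unbendRight e (b.Rm μ i j m f)) f := by
    rintro j rfl _ ⟨⟩
    exact heq_of_eq ((cup_cap'_isDuality hb μ j).curry_right f)
  exact key _ (bar_bar j) _ (b.cap_bar_heq μ j)

lemma Rm_Rd_heq (hb : b.IsVeined) {i j m : C.S} (f : C.Hd i j m) :
    HEq (b.Rm μ m (C.bar j) i (b.Rd μ i j m f)) f := by
  have key : ∀ (j' : C.S) (_ : j' = j) (c : 𝟙_ D ⟶ (C.bar j : D) ⊗ (j' : D)),
      HEq c (b.cup' μ j) → HEq (bendRight c (b.Rd μ i j m f)) f := by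
    rintro j rfl _ ⟨⟩
    exact heq_of_eq ((cup'_cap_isDuality hb μ j).uncurry_right f)
  exact key _ (bar_bar j) _ (b.cup_bar_heq μ j)

end Framing

/-! ### The generators on pure tensors and their Coxeter relations -/

/-- Linear maps on `H⁽⁴⁾` are determined by their values on pure tensors. -/
lemma H4_hom_ext {M : Type*} [AddCommGroup M] [Module k M] {f g : C.H4 →ₗ[k] M}
    (hF : ∀ (t : C.Idx) x₁ x₂ x₃ x₄, f (inF t (x₁ ⊗ₜ (x₂ ⊗ₜ (x₃ ⊗ₜ x₄)))) =
      g (inF t (x₁ ⊗ₜ (x₂ ⊗ₜ (x₃ ⊗ₜ x₄)))))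
    (hG : ∀ (t : C.Idx) x₁ x₂ x₃ x₄, f (inG t (x₁ ⊗ₜ (x₂ ⊗ₜ (x₃ ⊗ₜ x₄)))) =
      g (inG t (x₁ ⊗ₜ (x₂ ⊗ₜ (x₃ ⊗ₜ x₄))))) : f = g := by
  refine DirectSum.linearMap_ext k fun t => LinearMap.prod_ext ?_ ?_
  · refine TensorProduct.ext' fun x₁ y => ?_
    refine LinearMap.congr_fun (f := (f ∘ₗ inF t) ∘ₗ TensorProduct.mk k _ _ x₁)
      (g := (g ∘ₗ inF t) ∘ₗ TensorProduct.mk k _ _ x₁) ?_ y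
    refine TensorProduct.ext' fun x₂ y => ?_
    refine LinearMap.congr_fun
      (f := ((f ∘ₗ inF t) ∘ₗ TensorProduct.mk k _ _ x₁) ∘ₗ TensorProduct.mk k _ _ x₂)
      (g := ((g ∘ₗ inF t) ∘ₗ TensorProduct.mk k _ _ x₁) ∘ₗ TensorProduct.mk k _ _ x₂) ?_ y
    exact TensorProduct.ext' fun x₃ x₄ => hF t x₁ x₂ x₃ x₄
  · refine TensorProduct.ext' fun x₁ y => ?_
    refine LinearMap.congr_fun (f := (f ∘ₗ inG t) ∘ₗ TensorProduct.mk k _ _ x₁)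
      (g := (g ∘ₗ inG t) ∘ₗ TensorProduct.mk k _ _ x₁) ?_ y
    refine TensorProduct.ext' fun x₂ y => ?_
    refine LinearMap.congr_fun
      (f := ((f ∘ₗ inG t) ∘ₗ TensorProduct.mk k _ _ x₁) ∘ₗ TensorProduct.mk k _ _ x₂)
      (g := ((g ∘ₗ inG t) ∘ₗ TensorProduct.mk k _ _ x₁) ∘ₗ TensorProduct.mk k _ _ x₂) ?_ y
    exact TensorProduct.ext' fun x₃ x₄ => hG t x₁ x₂ x₃ x₄

/-- `inF` of a pure tensor, with explicit labels. -/
def pureF (i j r l p q : C.S) (x₁ : C.Hm j r p) (x₂ : C.Hd q r l) (x₃ : C.Hm i p l)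
    (x₄ : C.Hd i j q) : C.H4 :=
  inF ⟨i, j, r, l, p, q⟩ (x₁ ⊗ₜ (x₂ ⊗ₜ (x₃ ⊗ₜ x₄)))

/-- `inG` of a pure tensor, with explicit labels. -/
def pureG (i j r l p q : C.S) (x₁ : C.Hd j r p) (x₂ : C.Hm q r l) (x₃ : C.Hd i p l)
    (x₄ : C.Hm i j q) : C.H4 :=
  inG ⟨i, j, r, l, p, q⟩ (x₁ ⊗ₜ (x₂ ⊗ₜ (x₃ ⊗ₜ x₄)))

/-- Linear maps on `H⁽⁴⁾` are determined by their values on pure tensors with explicit labels. -/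
lemma H4_hom_ext' {M : Type*} [AddCommGroup M] [Module k M] {f g : C.H4 →ₗ[k] M}
    (hF : ∀ i j r l p q x₁ x₂ x₃ x₄, f (pureF i j r l p q x₁ x₂ x₃ x₄) =
      g (pureF i j r l p q x₁ x₂ x₃ x₄))
    (hG : ∀ i j r l p q x₁ x₂ x₃ x₄, f (pureG i j r l p q x₁ x₂ x₃ x₄) =
      g (pureG i j r l p q x₁ x₂ x₃ x₄)) : f = g :=
  H4_hom_ext (fun t => hF t.i t.j t.r t.l t.p t.q) (fun t => hG t.i t.j t.r t.l t.p t.q)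

namespace Framing

variable (b : C.Framing) (μ : C.S → kˣ) (i j r l p q : C.S)

lemma τ12_pureF (x₁ : C.Hm j r p) (x₂ : C.Hd q r l) (x₃ : C.Hm i p l) (x₄ : C.Hd i j q) :
    b.τ12 μ (pureF i j r l p q x₁ x₂ x₃ x₄) =
      pureG (C.bar i) q r p l j x₂ x₁ (b.Lm μ i p l x₃) (b.Ld μ i j q x₄) := by
  simp only [τ12, pureF, pureG, inF, LinearMap.comp_apply, DirectSum.toModule_lof,
    LinearMap.coprod_apply, LinearMap.inl_apply, map_zero, add_zero,
    permute12_tmul]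

lemma τ12_pureG (x₁ : C.Hd j r p) (x₂ : C.Hm q r l) (x₃ : C.Hd i p l) (x₄ : C.Hm i j q) :
    b.τ12 μ (pureG i j r l p q x₁ x₂ x₃ x₄) =
      pureF (C.bar i) q r p l j x₂ x₁ (b.Ld μ i p l x₃) (b.Lm μ i j q x₄) := by
  simp only [τ12, pureF, pureG, inG, LinearMap.comp_apply, DirectSum.toModule_lof,
    LinearMap.coprod_apply, LinearMap.inr_apply, map_zero, zero_add,
    permute12_tmul]

lemma τ23_pureF (x₁ : C.Hm j r p) (x₂ : C.Hd q r l) (x₃ : C.Hm i p l) (x₄ : C.Hd i j q) :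
    b.τ23 μ (pureF i j r l p q x₁ x₂ x₃ x₄) =
      pureG q (C.bar j) p l r i (b.Lm μ j r p x₁) x₃ x₂ (b.Rd μ i j q x₄) := by
  simp only [τ23, pureF, pureG, inF, LinearMap.comp_apply, DirectSum.toModule_lof,
    LinearMap.coprod_apply, LinearMap.inl_apply, map_zero, add_zero,
    permute23_tmul]

lemma τ23_pureG (x₁ : C.Hd j r p) (x₂ : C.Hm q r l) (x₃ : C.Hd i p l) (x₄ : C.Hm i j q) :
    b.τ23 μ (pureG i j r l p q x₁ x₂ x₃ x₄) =
      pureF q (C.bar j) p l r i (b.Ld μ j r p x₁) x₃ x₂ (b.Rm μ i j q x₄) := by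
  simp only [τ23, pureF, pureG, inG, LinearMap.comp_apply, DirectSum.toModule_lof,
    LinearMap.coprod_apply, LinearMap.inr_apply, map_zero, zero_add,
    permute23_tmul]

lemma τ34_pureF (x₁ : C.Hm j r p) (x₂ : C.Hd q r l) (x₃ : C.Hm i p l) (x₄ : C.Hd i j q) :
    b.τ34 μ (pureF i j r l p q x₁ x₂ x₃ x₄) =
      pureG i p (C.bar r) q j l (b.Rm μ j r p x₁) (b.Rd μ q r l x₂) x₄ x₃ := by
  simp only [τ34, pureF, pureG, inF, LinearMap.comp_apply, DirectSum.toModule_lof,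
    LinearMap.coprod_apply, LinearMap.inl_apply, map_zero, add_zero,
    permute34_tmul]

lemma τ34_pureG (x₁ : C.Hd j r p) (x₂ : C.Hm q r l) (x₃ : C.Hd i p l) (x₄ : C.Hm i j q) :
    b.τ34 μ (pureG i j r l p q x₁ x₂ x₃ x₄) =
      pureF i p (C.bar r) q j l (b.Rd μ j r p x₁) (b.Rm μ q r l x₂) x₄ x₃ := by
  simp only [τ34, pureF, pureG, inG, LinearMap.comp_apply, DirectSum.toModule_lof,
    LinearMap.coprod_apply, LinearMap.inr_apply, map_zero, zero_add,
    permute34_tmul]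

end Framing

section

variable {i i' j j' r r' l p q : C.S}

lemma pureF_congr_left (h : i' = i) {x₁ : C.Hm j r p} {x₂ : C.Hd q r l} {x₃ : C.Hm i p l}
    {x₄ : C.Hd i j q} {x₃' : C.Hm i' p l} {x₄' : C.Hd i' j q} (h₃ : HEq x₃' x₃)
    (h₄ : HEq x₄' x₄) :
    pureF i' j r l p q x₁ x₂ x₃' x₄' = pureF i j r l p q x₁ x₂ x₃ x₄ := by
  subst h; cases h₃; cases h₄; rfl

lemma pureG_congr_left (h : i' = i) {x₁ : C.Hd j r p} {x₂ : C.Hm q r l} {x₃ : C.Hd i p l}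
    {x₄ : C.Hm i j q} {x₃' : C.Hd i' p l} {x₄' : C.Hm i' j q} (h₃ : HEq x₃' x₃)
    (h₄ : HEq x₄' x₄) :
    pureG i' j r l p q x₁ x₂ x₃' x₄' = pureG i j r l p q x₁ x₂ x₃ x₄ := by
  subst h; cases h₃; cases h₄; rfl

lemma pureF_congr_middle (h : j' = j) {x₁ : C.Hm j r p} {x₂ : C.Hd q r l} {x₃ : C.Hm i p l}
    {x₄ : C.Hd i j q} {x₁' : C.Hm j' r p} {x₄' : C.Hd i j' q} (h₁ : HEq x₁' x₁)
    (h₄ : HEq x₄' x₄) :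
    pureF i j' r l p q x₁' x₂ x₃ x₄' = pureF i j r l p q x₁ x₂ x₃ x₄ := by
  subst h; cases h₁; cases h₄; rfl

lemma pureG_congr_middle (h : j' = j) {x₁ : C.Hd j r p} {x₂ : C.Hm q r l} {x₃ : C.Hd i p l}
    {x₄ : C.Hm i j q} {x₁' : C.Hd j' r p} {x₄' : C.Hm i j' q} (h₁ : HEq x₁' x₁)
    (h₄ : HEq x₄' x₄) :
    pureG i j' r l p q x₁' x₂ x₃ x₄' = pureG i j r l p q x₁ x₂ x₃ x₄ := by
  subst h; cases h₁; cases h₄; rfl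

lemma pureF_congr_right (h : r' = r) {x₁ : C.Hm j r p} {x₂ : C.Hd q r l} {x₃ : C.Hm i p l}
    {x₄ : C.Hd i j q} {x₁' : C.Hm j r' p} {x₂' : C.Hd q r' l} (h₁ : HEq x₁' x₁)
    (h₂ : HEq x₂' x₂) :
    pureF i j r' l p q x₁' x₂' x₃ x₄ = pureF i j r l p q x₁ x₂ x₃ x₄ := by
  subst h; cases h₁; cases h₂; rfl

lemma pureG_congr_right (h : r' = r) {x₁ : C.Hd j r p} {x₂ : C.Hm q r l} {x₃ : C.Hd i p l}
    {x₄ : C.Hm i j q} {x₁' : C.Hd j r' p} {x₂' : C.Hm q r' l} (h₁ : HEq x₁' x₁)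
    (h₂ : HEq x₂' x₂) :
    pureG i j r' l p q x₁' x₂' x₃ x₄ = pureG i j r l p q x₁ x₂ x₃ x₄ := by
  subst h; cases h₁; cases h₂; rfl

end

namespace Framing

variable {b : C.Framing} (μ : C.S → kˣ)

lemma τ12_mul_self (hb : b.IsVeined) : (b.τ12 μ) * (b.τ12 μ) = 1 :=
  H4_hom_ext'
    (fun _ _ _ _ _ _ _ _ _ _ => by
      rw [Module.End.mul_apply, τ12_pureF, τ12_pureG, Module.End.one_apply]
      exact pureF_congr_left (bar_bar _) (Ld_Lm_heq μ hb _) (Lm_Ld_heq μ hb _))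
    (fun _ _ _ _ _ _ _ _ _ _ => by
      rw [Module.End.mul_apply, τ12_pureG, τ12_pureF, Module.End.one_apply]
      exact pureG_congr_left (bar_bar _) (Lm_Ld_heq μ hb _) (Ld_Lm_heq μ hb _))

lemma τ23_mul_self (hb : b.IsVeined) : (b.τ23 μ) * (b.τ23 μ) = 1 :=
  H4_hom_ext'
    (fun _ _ _ _ _ _ _ _ _ _ => by
      rw [Module.End.mul_apply, τ23_pureF, τ23_pureG, Module.End.one_apply]
      exact pureF_congr_middle (bar_bar _) (Ld_Lm_heq μ hb _) (Rm_Rd_heq μ hb _))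
    (fun _ _ _ _ _ _ _ _ _ _ => by
      rw [Module.End.mul_apply, τ23_pureG, τ23_pureF, Module.End.one_apply]
      exact pureG_congr_middle (bar_bar _) (Lm_Ld_heq μ hb _) (Rd_Rm_heq μ hb _))

lemma τ34_mul_self (hb : b.IsVeined) : (b.τ34 μ) * (b.τ34 μ) = 1 :=
  H4_hom_ext'
    (fun _ _ _ _ _ _ _ _ _ _ => by
      rw [Module.End.mul_apply, τ34_pureF, τ34_pureG, Module.End.one_apply]
      exact pureF_congr_right (bar_bar _) (Rd_Rm_heq μ hb _) (Rm_Rd_heq μ hb _))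
    (fun _ _ _ _ _ _ _ _ _ _ => by
      rw [Module.End.mul_apply, τ34_pureG, τ34_pureF, Module.End.one_apply]
      exact pureG_congr_right (bar_bar _) (Rm_Rd_heq μ hb _) (Rd_Rm_heq μ hb _))

lemma τ12_mul_τ34 : b.τ12 μ * b.τ34 μ = b.τ34 μ * b.τ12 μ :=
  H4_hom_ext'
    (fun _ _ _ _ _ _ _ _ _ _ => by
      rw [Module.End.mul_apply, Module.End.mul_apply, τ34_pureF, τ12_pureG, τ12_pureF, τ34_pureG])
    (fun _ _ _ _ _ _ _ _ _ _ => by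
      rw [Module.End.mul_apply, Module.End.mul_apply, τ34_pureG, τ12_pureF, τ12_pureG, τ34_pureF])

/-- Compared with `τ23_braid_pureG`, the labels and the first three factors coincide; the only
discrepancy is the direction in which x₄ is rotated. -/
lemma τ12_braid_pureG (i j r l p q : C.S) (x₁ : C.Hd j r p) (x₂ : C.Hm q r l) (x₃ : C.Hd i p l)
    (x₄ : C.Hm i j q) :
    b.τ12 μ (b.τ23 μ (b.τ12 μ (pureG i j r l p q x₁ x₂ x₃ x₄))) =
      pureF (C.bar j) (C.bar i) l r p (C.bar q) (b.Ld μ i p l x₃) (b.Lm μ q r l x₂)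
        (b.Ld μ j r p x₁)
        (b.Lm μ j (C.bar q) (C.bar i) (b.Rd μ (C.bar i) q j (b.Lm μ i j q x₄))) := by
  rw [τ12_pureG, τ23_pureF, τ12_pureG]

lemma τ23_braid_pureG (i j r l p q : C.S) (x₁ : C.Hd j r p) (x₂ : C.Hm q r l) (x₃ : C.Hd i p l)
    (x₄ : C.Hm i j q) :
    b.τ23 μ (b.τ12 μ (b.τ23 μ (pureG i j r l p q x₁ x₂ x₃ x₄))) =
      pureF (C.bar j) (C.bar i) l r p (C.bar q) (b.Ld μ i p l x₃) (b.Lm μ q r l x₂)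
        (b.Ld μ j r p x₁)
        (b.Rm μ (C.bar q) i (C.bar j) (b.Ld μ q (C.bar j) i (b.Rm μ i j q x₄))) := by
  rw [τ23_pureG, τ12_pureF, τ23_pureG]

lemma τ12_braid (hb : b.IsVeined)
    (h : ∀ (i j m : C.S) (f : C.Hm i j m), b.doubleDual μ f = f) :
    b.τ12 μ * b.τ23 μ * b.τ12 μ = b.τ23 μ * b.τ12 μ * b.τ23 μ := by
  have hG : ∀ i j r l p q x₁ x₂ x₃ x₄,
      b.τ12 μ (b.τ23 μ (b.τ12 μ (pureG i j r l p q x₁ x₂ x₃ x₄))) =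
        b.τ23 μ (b.τ12 μ (b.τ23 μ (pureG i j r l p q x₁ x₂ x₃ x₄))) := by
    intro i j r l p q x₁ x₂ x₃ x₄
    rw [τ12_braid_pureG, τ23_braid_pureG, (doubleDual_eq_iff μ hb x₄).1 (h i j q x₄)]
  have h₁ : ∀ x, b.τ12 μ (b.τ12 μ x) = x := LinearMap.congr_fun (τ12_mul_self μ hb)
  have h₂ : ∀ x, b.τ23 μ (b.τ23 μ x) = x := LinearMap.congr_fun (τ23_mul_self μ hb)
  refine H4_hom_ext' (fun i j r l p q x₁ x₂ x₃ x₄ => ?_) (fun _ _ _ _ _ _ _ _ _ _ => hG ..)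
  change b.τ12 μ (b.τ23 μ (b.τ12 μ _)) = b.τ23 μ (b.τ12 μ (b.τ23 μ _))
  -- For involutions, the braid relation at τ₁₂ y follows from the one at y, which carries it from
  -- the second kind of summand to the first.
  rw [← h₁ (pureF i j r l p q x₁ x₂ x₃ x₄), τ12_pureF, hG, h₁, h₂]

/-- Here the full rotation falls on x₁ instead of x₄. -/
lemma τ34_braid (hb : b.IsVeined)
    (h : ∀ (i j m : C.S) (f : C.Hm i j m), b.doubleDual μ f = f) :
    b.τ23 μ * b.τ34 μ * b.τ23 μ = b.τ34 μ * b.τ23 μ * b.τ34 μ := by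
  have hF : ∀ i j r l p q x₁ x₂ x₃ x₄,
      b.τ23 μ (b.τ34 μ (b.τ23 μ (pureF i j r l p q x₁ x₂ x₃ x₄))) =
        b.τ34 μ (b.τ23 μ (b.τ34 μ (pureF i j r l p q x₁ x₂ x₃ x₄))) := by
    intro i j r l p q x₁ x₂ x₃ x₄
    rw [τ23_pureF, τ34_pureG, τ23_pureF, τ34_pureF, τ23_pureG, τ34_pureF,
      (doubleDual_eq_iff μ hb x₁).1 (h j r p x₁)]
  have h₁ : ∀ x, b.τ34 μ (b.τ34 μ x) = x := LinearMap.congr_fun (τ34_mul_self μ hb)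
  have h₂ : ∀ x, b.τ23 μ (b.τ23 μ x) = x := LinearMap.congr_fun (τ23_mul_self μ hb)
  refine H4_hom_ext' (fun _ _ _ _ _ _ _ _ _ _ => hF ..) (fun i j r l p q x₁ x₂ x₃ x₄ => ?_)
  change b.τ23 μ (b.τ34 μ (b.τ23 μ _)) = b.τ34 μ (b.τ23 μ (b.τ34 μ _))
  rw [← h₁ (pureG i j r l p q x₁ x₂ x₃ x₄), τ34_pureG, ← hF, h₁, h₂]

end Framing

end PreFusionCategory

end

/-! ### Necessity of a trivial double dual -/

section

/-- Pure tensors of nonzero vectors over a field do not vanish. -/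
lemma tmul_ne_zero {k V W : Type*} [Field k] [AddCommGroup V] [Module k V] [AddCommGroup W]
    [Module k W] {x : V} {y : W} (hx : x ≠ 0) (hy : y ≠ 0) : x ⊗ₜ[k] y ≠ 0 := by
  intro h
  refine hx ((Module.forall_dual_apply_eq_zero_iff k x).1 fun f => ?_)
  have h₁ := congrArg (TensorProduct.lid k W ∘ TensorProduct.map f LinearMap.id) h
  simp only [Function.comp_apply, TensorProduct.map_tmul, TensorProduct.lid_tmul, map_zero,
    LinearMap.id_apply] at h₁
  exact (smul_eq_zero.1 h₁).resolve_right hy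

/-- Induction on vectors along a basis. -/
lemma basis_induction {k V ι : Type*} [Field k] [AddCommGroup V] [Module k V]
    (e : Module.Basis ι k V) {P : V → Prop} (h : ∀ x, P (e x)) (h₀ : P 0)
    (hadd : ∀ x y, P x → P y → P (x + y)) (hsmul : ∀ (c : k) x, P x → P (c • x)) (x : V) : P x := by
  have hx : x ∈ Submodule.span k (Set.range e) := e.span_eq ▸ Submodule.mem_top
  induction hx using Submodule.span_induction with
  | mem x hx => obtain ⟨y, rfl⟩ := hx; exact h y
  | zero => exact h₀
  | add x y _ _ hx hy => exact hadd x y hx hy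
  | smul c x _ hx => exact hsmul c x hx

namespace PreFusionCategory

variable {k : Type w} [Field k] {D : Type u} [Category.{v} D] [Preadditive D]
  [Linear k D] [MonoidalCategory D] [MonoidalPreadditive D] [MonoidalLinear k D]
  {C : PreFusionCategory k D}

lemma inF_injective (t : C.Idx) : Function.Injective (inF t) :=
  (DirectSum.of_injective (β := fun t : C.Idx => HF t × HG t) t).comp LinearMap.inl_injective

lemma pureF_ne_zero {i j r l p q : C.S} {x₁ : C.Hm j r p} {x₂ : C.Hd q r l} {x₃ : C.Hm i p l}
    {x₄ : C.Hd i j q} (h₁ : x₁ ≠ 0) (h₂ : x₂ ≠ 0) (h₃ : x₃ ≠ 0) (h₄ : x₄ ≠ 0) :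
    pureF i j r l p q x₁ x₂ x₃ x₄ ≠ 0 :=
  (map_ne_zero_iff _ (inF_injective _)).2
    (tmul_ne_zero h₁ (tmul_ne_zero h₂ (tmul_ne_zero h₃ h₄)))

lemma pureF_sub {i j r l p q : C.S} (x₁ : C.Hm j r p) (x₂ : C.Hd q r l) (x₃ : C.Hm i p l)
    (x₄ y₄ : C.Hd i j q) :
    pureF i j r l p q x₁ x₂ x₃ (x₄ - y₄) =
      pureF i j r l p q x₁ x₂ x₃ x₄ - pureF i j r l p q x₁ x₂ x₃ y₄ := by
  simp only [pureF, TensorProduct.tmul_sub, map_sub]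

namespace Framing

variable {b : C.Framing} (μ : C.S → kˣ)

lemma Ld_ne_zero (hb : b.IsVeined) {i j m : C.S} {f : C.Hd i j m} (hf : f ≠ 0) :
    b.Ld μ i j m f ≠ 0 := by
  intro h
  have h₁ := (cup_cap'_isDuality hb μ i).uncurry_left f
  change _ ≫ _ ≫ _ ≫ _ ◁ b.Ld μ i j m f = f at h₁
  rw [h] at h₁
  simp only [MonoidalPreadditive.whiskerLeft_zero, comp_zero] at h₁
  exact hf h₁.symm

lemma Lm_ne_zero (hb : b.IsVeined) {i j m : C.S} {f : C.Hm i j m} (hf : f ≠ 0) :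
    b.Lm μ i j m f ≠ 0 := by
  intro h
  have h₁ := (cup'_cap_isDuality hb μ i).curry_left f
  change _ ◁ b.Lm μ i j m f ≫ _ = f at h₁
  rw [h] at h₁
  simp only [MonoidalPreadditive.whiskerLeft_zero, zero_comp] at h₁
  exact hf h₁.symm

/-- The braid relation between `τ₁₂` and `τ₂₃` forces the double dual to be trivial. -/
lemma doubleDual_eq_of_braid (hb : b.IsVeined)
    (h : b.τ12 μ * b.τ23 μ * b.τ12 μ = b.τ23 μ * b.τ12 μ * b.τ23 μ) {i j m : C.S}
    (f : C.Hm i j m) : b.doubleDual μ f = f := by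
  by_cases hf : f = 0
  · subst hf
    simpa using doubleDual_sub (b := b) μ (0 : C.Hm i j m) 0
  obtain ⟨g, hg⟩ : ∃ g : C.Hd i j m, g ≠ 0 := by
    by_contra! hg
    exact hf (hom_ext_left fun a => by rw [hg a, zero_comp, zero_comp])
  have hρ : ∀ n : C.S, (ρ_ (n : D)).hom ≠ 0 := fun n h₀ => C.id_ne_zero n (by
    rw [← (ρ_ (n : D)).inv_hom_id, h₀, comp_zero])
  have hρ' : ∀ n : C.S, (ρ_ (n : D)).inv ≠ 0 := fun n h₀ => C.id_ne_zero n (by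
    rw [← (ρ_ (n : D)).inv_hom_id, h₀, zero_comp])
  -- With r = 1 the first two factors can be unitors. Together with g ≠ 0 this keeps the other three
  -- factors nonzero after bending, so the two rotations of f can be compared by cancelling them.
  have h₁ := LinearMap.congr_fun h (pureG i j C.one m j m (ρ_ (j : D)).inv (ρ_ (m : D)).hom g f)
  have h₂ := (τ12_braid_pureG (b := b) μ i j C.one m j m (ρ_ (j : D)).inv (ρ_ (m : D)).hom g
    f).symm.trans (h₁.trans (τ23_braid_pureG ..))
  rw [doubleDual_eq_iff μ hb, ← sub_eq_zero]
  by_contra hne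
  refine pureF_ne_zero (Ld_ne_zero μ hb hg) (Lm_ne_zero μ hb (hρ m))
    (Ld_ne_zero (j := C.one) μ hb (hρ' j)) hne ?_
  rw [pureF_sub, h₂, sub_self]

/-! ### Basis-free evaluation of `𝔽` -/

namespace RootChoice

variable {μ} (s : b.RootChoice μ)

lemma 𝔽_pureF_basis (i j r l p q : C.S) (β δ α γ) :
    s.𝔽 (pureF i j r l p q (b.basis j r p β) (b.dbasis q r l δ) (b.basis i p l α)
      (b.dbasis i j q γ)) = s.root l * b.sixJ i j r l p q α β γ δ := by
  simp only [𝔽, pureF, inF, LinearMap.comp_apply, DirectSum.toModule_lof,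
    LinearMap.coprod_apply, LinearMap.inl_apply, map_zero, add_zero]
  rw [← Module.Basis.tensorProduct_apply, ← Module.Basis.tensorProduct_apply,
    ← Module.Basis.tensorProduct_apply, onHF]
  exact Module.Basis.constr_basis ..

lemma 𝔽_pureG_basis (i j r l p q : C.S) (β δ α γ) :
    s.𝔽 (pureG i j r l p q (b.dbasis j r p β) (b.basis q r l δ) (b.dbasis i p l α)
      (b.basis i j q γ)) = s.root l * b.sixJInv i j r l q p γ δ α β := by
  simp only [𝔽, pureG, inG, LinearMap.comp_apply, DirectSum.toModule_lof,
    LinearMap.coprod_apply, LinearMap.inr_apply, map_zero, zero_add]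
  rw [← Module.Basis.tensorProduct_apply, ← Module.Basis.tensorProduct_apply,
    ← Module.Basis.tensorProduct_apply, onHG]
  exact Module.Basis.constr_basis ..

/-- Coefficients with respect to `leftBasis` are read off by composing with dual basis vectors, so
on basis elements the 6j-symbol is this scalar; both sides are linear in each factor. -/
lemma 𝔽_pureF (i j r l p q : C.S) (x₁ : C.Hm j r p) (x₂ : C.Hd q r l) (x₃ : C.Hm i p l)
    (x₄ : C.Hd i j q) :
    s.𝔽 (pureF i j r l p q x₁ x₂ x₃ x₄) = s.root l * C.scalar l
      (x₂ ≫ x₄ ▷ (r : D) ≫ (α_ (i : D) (j : D) (r : D)).hom ≫ (i : D) ◁ x₁ ≫ x₃) := by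
  induction x₁ using basis_induction (b.basis j r p) with
  | h₀ => simp [pureF]
  | hadd x y hx hy =>
    simp only [pureF] at hx hy ⊢
    simp only [TensorProduct.add_tmul, map_add, hx, hy, MonoidalPreadditive.whiskerLeft_add,
      Preadditive.add_comp, Preadditive.comp_add, mul_add]
  | hsmul c x hx =>
    simp only [pureF] at hx ⊢
    simp only [← TensorProduct.smul_tmul', map_smul, hx, MonoidalLinear.whiskerLeft_smul,
      Linear.smul_comp, Linear.comp_smul, smul_eq_mul]
    ring
  | h β =>
  induction x₂ using basis_induction (b.dbasis q r l) with
  | h₀ => simp [pureF]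
  | hadd x y hx hy =>
    simp only [pureF] at hx hy ⊢
    simp only [TensorProduct.add_tmul, TensorProduct.tmul_add, map_add, hx, hy,
      Preadditive.add_comp, mul_add]
  | hsmul c x hx =>
    simp only [pureF] at hx ⊢
    simp only [← TensorProduct.smul_tmul', TensorProduct.tmul_smul, map_smul, hx,
      Linear.smul_comp, smul_eq_mul]
    ring
  | h δ =>
  induction x₃ using basis_induction (b.basis i p l) with
  | h₀ => simp [pureF]
  | hadd x y hx hy =>
    simp only [pureF] at hx hy ⊢
    simp only [TensorProduct.add_tmul, TensorProduct.tmul_add, map_add, hx, hy,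
      Preadditive.comp_add, mul_add]
  | hsmul c x hx =>
    simp only [pureF] at hx ⊢
    simp only [← TensorProduct.smul_tmul', TensorProduct.tmul_smul, map_smul, hx,
      Linear.comp_smul, smul_eq_mul]
    ring
  | h α =>
  induction x₄ using basis_induction (b.dbasis i j q) with
  | h₀ => simp [pureF]
  | hadd x y hx hy =>
    simp only [pureF] at hx hy ⊢
    simp only [TensorProduct.tmul_add, map_add, hx, hy, MonoidalPreadditive.add_whiskerRight,
      Preadditive.add_comp, Preadditive.comp_add, mul_add]
  | hsmul c x hx =>
    simp only [pureF] at hx ⊢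
    simp only [TensorProduct.tmul_smul, map_smul, hx, MonoidalLinear.smul_whiskerRight,
      Linear.smul_comp, Linear.comp_smul, smul_eq_mul]
    ring
  | h γ => rw [𝔽_pureF_basis, sixJ, leftBasis_repr]

lemma 𝔽_pureG (i j r l p q : C.S) (x₁ : C.Hd j r p) (x₂ : C.Hm q r l) (x₃ : C.Hd i p l)
    (x₄ : C.Hm i j q) :
    s.𝔽 (pureG i j r l p q x₁ x₂ x₃ x₄) = s.root l * C.scalar l
      (x₃ ≫ (i : D) ◁ x₁ ≫ (α_ (i : D) (j : D) (r : D)).inv ≫ x₄ ▷ (r : D) ≫ x₂) := by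
  induction x₁ using basis_induction (b.dbasis j r p) with
  | h₀ => simp [pureG]
  | hadd x y hx hy =>
    simp only [pureG] at hx hy ⊢
    simp only [TensorProduct.add_tmul, map_add, hx, hy, MonoidalPreadditive.whiskerLeft_add,
      Preadditive.add_comp, Preadditive.comp_add, mul_add]
  | hsmul c x hx =>
    simp only [pureG] at hx ⊢
    simp only [← TensorProduct.smul_tmul', map_smul, hx, MonoidalLinear.whiskerLeft_smul,
      Linear.smul_comp, Linear.comp_smul, smul_eq_mul]
    ring
  | h β =>
  induction x₂ using basis_induction (b.basis q r l) with
  | h₀ => simp [pureG]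
  | hadd x y hx hy =>
    simp only [pureG] at hx hy ⊢
    simp only [TensorProduct.add_tmul, TensorProduct.tmul_add, map_add, hx, hy,
      Preadditive.comp_add, mul_add]
  | hsmul c x hx =>
    simp only [pureG] at hx ⊢
    simp only [← TensorProduct.smul_tmul', TensorProduct.tmul_smul, map_smul, hx,
      Linear.comp_smul, smul_eq_mul]
    ring
  | h δ =>
  induction x₃ using basis_induction (b.dbasis i p l) with
  | h₀ => simp [pureG]
  | hadd x y hx hy =>
    simp only [pureG] at hx hy ⊢
    simp only [TensorProduct.add_tmul, TensorProduct.tmul_add, map_add, hx, hy,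
      Preadditive.add_comp, mul_add]
  | hsmul c x hx =>
    simp only [pureG] at hx ⊢
    simp only [← TensorProduct.smul_tmul', TensorProduct.tmul_smul, map_smul, hx,
      Linear.smul_comp, smul_eq_mul]
    ring
  | h α =>
  induction x₄ using basis_induction (b.basis i j q) with
  | h₀ => simp [pureG]
  | hadd x y hx hy =>
    simp only [pureG] at hx hy ⊢
    simp only [TensorProduct.tmul_add, map_add, hx, hy, MonoidalPreadditive.add_whiskerRight,
      Preadditive.add_comp, Preadditive.comp_add, mul_add]
  | hsmul c x hx =>
    simp only [pureG] at hx ⊢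
    simp only [TensorProduct.tmul_smul, map_smul, hx, MonoidalLinear.smul_whiskerRight,
      Linear.smul_comp, Linear.comp_smul, smul_eq_mul]
    ring
  | h γ => rw [𝔽_pureG_basis, sixJInv, rightBasis_repr]

end RootChoice
end Framing
end PreFusionCategory

end

/-! ### Invariance of `𝔽` under the generators -/

section

section

variable {D : Type u} [Category.{v} D] [MonoidalCategory D] {i i' j r r' p q l : D}

/-- Bending the first target leg of a composite. -/
lemma unbendLeft_comp (e : i' ⊗ i ⟶ 𝟙_ D) (x₁ : j ⊗ r ⟶ p) (x₂ : l ⟶ q ⊗ r) (x₄ : q ⟶ i ⊗ j) :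
    unbendLeft e (x₂ ≫ x₄ ▷ r ≫ (α_ i j r).hom ≫ i ◁ x₁) =
      i' ◁ x₂ ≫ (α_ i' q r).inv ≫ unbendLeft e x₄ ▷ r ≫ x₁ := by
  calc unbendLeft e (x₂ ≫ x₄ ▷ r ≫ (α_ i j r).hom ≫ i ◁ x₁)
      = 𝟙 _ ⊗≫ i' ◁ x₂ ⊗≫ i' ◁ x₄ ▷ r ⊗≫ ((i' ⊗ i) ◁ x₁ ≫ e ▷ p) ⊗≫ 𝟙 _ := by
        simp only [unbendLeft]; monoidal
    _ = _ := by
        rw [whisker_exchange]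
        simp only [unbendLeft]; monoidal

/-- Bending the second source leg of a composite. -/
lemma bendRight_comp (c : 𝟙_ D ⟶ r ⊗ r') (x₁ : j ⊗ r ⟶ p) (x₃ : i ⊗ p ⟶ l) (x₄ : q ⟶ i ⊗ j) :
    bendRight c (x₄ ▷ r ≫ (α_ i j r).hom ≫ i ◁ x₁ ≫ x₃) =
      x₄ ≫ i ◁ bendRight c x₁ ≫ (α_ i p r').inv ≫ x₃ ▷ r' := by
  calc bendRight c (x₄ ▷ r ≫ (α_ i j r).hom ≫ i ◁ x₁ ≫ x₃)
      = 𝟙 _ ⊗≫ (q ◁ c ≫ x₄ ▷ (r ⊗ r')) ⊗≫ i ◁ x₁ ▷ r' ⊗≫ x₃ ▷ r' := by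
        simp only [bendRight]; monoidal
    _ = _ := by
        rw [whisker_exchange]
        simp only [bendRight]; monoidal

end

namespace PreFusionCategory

variable {k : Type w} [Field k] {D : Type u} [Category.{v} D] [Preadditive D]
  [Linear k D] [MonoidalCategory D] [MonoidalPreadditive D] [MonoidalLinear k D]
  {C : PreFusionCategory k D}

namespace Framing.RootChoice

variable {b : C.Framing} {μ : C.S → kˣ} (s : b.RootChoice μ)

/-- Bending the internal strand j to the other side leaves the composite endomorphism of l unchanged
(`bend_middle`), and τ₂₃ keeps the label l. No condition on dimensions or signs enters. -/
lemma 𝔽_τ23 (hb : b.IsVeined) (x : C.H4) : s.𝔽 (b.τ23 μ x) = s.𝔽 x := by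
  have hF : ∀ i j r l p q x₁ x₂ x₃ x₄, s.𝔽 (b.τ23 μ (pureF i j r l p q x₁ x₂ x₃ x₄)) =
      s.𝔽 (pureF i j r l p q x₁ x₂ x₃ x₄) := by
    intro i j r l p q x₁ x₂ x₃ x₄
    rw [τ23_pureF, 𝔽_pureG, 𝔽_pureF]
    have h := bend_middle (cup'_cap_isDuality hb μ j) x₄ x₁
    have h' := congrArg (fun y => x₂ ≫ y ≫ x₃) h
    simp only [Category.assoc] at h'
    exact congrArg (fun y => s.root l * C.scalar l y) h'
  have h₁ : ∀ x, b.τ23 μ (b.τ23 μ x) = x := LinearMap.congr_fun (τ23_mul_self μ hb)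
  refine LinearMap.congr_fun (f := s.𝔽 ∘ₗ b.τ23 μ) (H4_hom_ext' hF ?_) x
  intro i j r l p q x₁ x₂ x₃ x₄
  rw [← h₁ (pureG i j r l p q x₁ x₂ x₃ x₄), τ23_pureG, LinearMap.comp_apply, h₁, hF]

/-- The factors other than x₃ compose to a single g : l ⟶ i ⊗ p whose left bend is the composite of
the bent factors, so invariance reduces to the comparison of x₃ and g in the hypothesis. -/
lemma 𝔽_τ12 (hb : b.IsVeined) (h : ∀ (i p l : C.S) (f : C.Hm i p l) (g : C.Hd i p l),
    s.root p * C.scalar p (b.Lm μ i p l f ≫ b.Ld μ i p l g) = s.root l * C.scalar l (g ≫ f))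
    (x : C.H4) : s.𝔽 (b.τ12 μ x) = s.𝔽 x := by
  have hF : ∀ i j r l p q x₁ x₂ x₃ x₄, s.𝔽 (b.τ12 μ (pureF i j r l p q x₁ x₂ x₃ x₄)) =
      s.𝔽 (pureF i j r l p q x₁ x₂ x₃ x₄) := by
    intro i j r l p q x₁ x₂ x₃ x₄
    rw [τ12_pureF, 𝔽_pureG, 𝔽_pureF]
    have h₀ := h i p l x₃ (x₂ ≫ x₄ ▷ (r : D) ≫ (α_ (i : D) (j : D) (r : D)).hom ≫ (i : D) ◁ x₁)
    simp only [Category.assoc] at h₀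
    rw [← h₀]
    exact congrArg (fun y => s.root p * C.scalar p (b.Lm μ i p l x₃ ≫ y))
      (unbendLeft_comp (b.cap' μ i) x₁ x₂ x₄).symm
  have h₁ : ∀ x, b.τ12 μ (b.τ12 μ x) = x := LinearMap.congr_fun (τ12_mul_self μ hb)
  refine LinearMap.congr_fun (f := s.𝔽 ∘ₗ b.τ12 μ) (H4_hom_ext' hF ?_) x
  intro i j r l p q x₁ x₂ x₃ x₄
  rw [← h₁ (pureG i j r l p q x₁ x₂ x₃ x₄), τ12_pureG, LinearMap.comp_apply, h₁, hF]

/-- All factors except x₂ compose to one morphism q ⊗ r ⟶ l, and bending r passes through this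
composite. -/
lemma 𝔽_τ34_pureF (i j r l p q : C.S) (x₁ : C.Hm j r p) (x₂ : C.Hd q r l) (x₃ : C.Hm i p l)
    (x₄ : C.Hd i j q) :
    s.𝔽 (b.τ34 μ (pureF i j r l p q x₁ x₂ x₃ x₄)) = s.root q * C.scalar q
      (b.Rm μ q r l (x₄ ▷ (r : D) ≫ (α_ (i : D) (j : D) (r : D)).hom ≫ (i : D) ◁ x₁ ≫ x₃) ≫
        b.Rd μ q r l x₂) := by
  rw [τ34_pureF, 𝔽_pureG]
  have h := congrArg (fun y => y ≫ b.Rd μ q r l x₂) (bendRight_comp (b.cup μ r) x₁ x₃ x₄)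
  simp only [Category.assoc] at h
  exact congrArg (fun y => s.root q * C.scalar q y) h.symm

lemma 𝔽_τ34 (hb : b.IsVeined) (h : ∀ (q r l : C.S) (f : C.Hm q r l) (g : C.Hd q r l),
    s.root q * C.scalar q (b.Rm μ q r l f ≫ b.Rd μ q r l g) = s.root l * C.scalar l (g ≫ f))
    (x : C.H4) : s.𝔽 (b.τ34 μ x) = s.𝔽 x := by
  have hF : ∀ i j r l p q x₁ x₂ x₃ x₄, s.𝔽 (b.τ34 μ (pureF i j r l p q x₁ x₂ x₃ x₄)) =
      s.𝔽 (pureF i j r l p q x₁ x₂ x₃ x₄) := fun i j r l p q x₁ x₂ x₃ x₄ => by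
    rw [𝔽_τ34_pureF, 𝔽_pureF, h]
  have h₁ : ∀ x, b.τ34 μ (b.τ34 μ x) = x := LinearMap.congr_fun (τ34_mul_self μ hb)
  refine LinearMap.congr_fun (f := s.𝔽 ∘ₗ b.τ34 μ) (H4_hom_ext' hF ?_) x
  intro i j r l p q x₁ x₂ x₃ x₄
  rw [← h₁ (pureG i j r l p q x₁ x₂ x₃ x₄), τ34_pureG, LinearMap.comp_apply, h₁, hF]

/-- Invariance of `𝔽` under `τ₃₄` relates scalars of closed diagrams to partial right traces. -/
lemma scalar_of_𝔽_τ34 (h : ∀ x : C.H4, s.𝔽 (b.τ34 μ x) = s.𝔽 x) {q r l : C.S}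
    (f : C.Hm q r l) (g : C.Hd q r l) :
    s.root q * C.scalar q (b.Rm μ q r l f ≫ b.Rd μ q r l g) = s.root l * C.scalar l (g ≫ f) := by
  -- Setting i = 1 and using unitors for the last two factors makes the composite equal to f.
  have h₁ := h (pureF C.one q r l l q f g (λ_ (l : D)).hom (λ_ (q : D)).inv)
  rw [𝔽_τ34_pureF, 𝔽_pureF] at h₁
  have h₂ : (λ_ (q : D)).inv ▷ (r : D) ≫ (α_ (𝟙_ D) (q : D) (r : D)).hom ≫ 𝟙_ D ◁ f ≫
      (λ_ (l : D)).hom = f := by simp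
  rwa [h₂] at h₁

end Framing.RootChoice

/-! ### Roots, dimensions and signs -/

namespace Framing

variable {b : C.Framing} {μ : C.S → kˣ}

/-- If the double dual is trivial and `𝔽` is invariant under `τ₃₄`, the chosen roots are the
dimensions. -/
lemma RootChoice.root_eq_dimL (s : b.RootChoice μ) (hb : b.IsVeined)
    (hD : ∀ (i j m : C.S) (f : C.Hm i j m), b.doubleDual μ f = f)
    (h : ∀ x : C.H4, s.𝔽 (b.τ34 μ x) = s.𝔽 x) (i : C.S) : s.root i = b.dimL μ i := by
  have h₁ := s.scalar_of_𝔽_τ34 h (l := C.one) (b.ev i) (b.coev i)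
  have h₂ := scalar_right_partial_trace (m := C.one) μ hb (b.ev i) (b.coev i)
  rw [hD] at h₂
  have h₃ : s.root C.one = b.dimL μ C.one :=
    s.root_of_eq _ (congrArg (b.dimL μ) bar_one.symm)
  have h₄ : C.scalar C.one (b.coev i ≫ b.ev i) = 1 := by
    rw [coev_comp_ev]
    exact C.scalar_id C.one
  rw [h₃, ← h₂] at h₁
  -- Both the root and d_i, multiplied by the same partial trace, give d_1; since d_1 ≠ 0, the
  -- partial trace can be cancelled.
  refine mul_right_cancel₀ (fun h₅ => ?_) h₁
  rw [h₅, mul_zero, h₄, mul_one] at h₂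
  exact dimL_ne_zero μ hb C.one h₂.symm

/-- If all dimensions are two-sided and all signs are `1`, the double dual is trivial. -/
lemma RootChoice.doubleDual_eq_self (s : b.RootChoice μ) (hb : b.IsVeined)
    (hd : ∀ i, b.dimL μ i = b.dimR μ i)
    (hε : ∀ (i j m : C.S) (α : C.Hm i j m) (ε : k), s.IsSign α ε → ε = 1) [CharZero k]
    (i j m : C.S) (f : C.Hm i j m) : b.doubleDual μ f = f := by
  have hrel : ∀ i, s.relRoot i = 1 := fun i => by
    rw [relRoot, s.root_of_eq i (by rw [dimL_bar, hd]), div_self (dimL_ne_zero μ hb i)]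
  by_contra hne
  -- The double dual is an involution here, so the difference is a (-1)-eigenvector; all relative
  -- roots being 1, its sign is -1, and -1 ≠ 1 in characteristic zero.
  have h : b.doubleDual μ (b.doubleDual μ f - f) = -(b.doubleDual μ f - f) := by
    rw [doubleDual_sub, doubleDual_doubleDual μ hb hd, neg_sub]
  have h₁ := hε i j m (b.doubleDual μ f - f) (-1)
    ⟨sub_ne_zero.2 hne, Or.inr rfl, by rw [h, hrel, hrel, hrel]; simp⟩
  norm_num at h₁

end Framing
end PreFusionCategory

end

end Veined

end

/-! ### The equivalence -/

theorem theorem4p6 {k : Type*} [Field k] [IsAlgClosed k] [CharZero k]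
    {D : Type*} [Category D] [Preadditive D] [Linear k D] [MonoidalCategory D]
    [MonoidalPreadditive D] [MonoidalLinear k D]
    (C : Veined.PreFusionCategory k D) (b : C.Framing) (hb : b.IsVeined) (μ : C.S → kˣ)
    (s : b.RootChoice μ) :
    (∃ ρ : Representation k (Equiv.Perm (Fin 4)) C.H4,
        ρ (Equiv.swap 0 1) = b.τ12 μ ∧ ρ (Equiv.swap 1 2) = b.τ23 μ ∧
        ρ (Equiv.swap 2 3) = b.τ34 μ ∧
        ∀ (g : Equiv.Perm (Fin 4)) (x : C.H4), s.𝔽 (ρ g⁻¹ x) = s.𝔽 x) ↔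
      (∀ i : C.S, b.dimL μ i = b.dimR μ i) ∧
      (∀ (i j m : C.S) (α : C.Hm i j m) (ε : k), s.IsSign α ε → ε = 1) := by
  open Veined.PreFusionCategory Veined.PreFusionCategory.Framing in
  constructor
  · rintro ⟨ρ, h12, h23, h34, hinv⟩
    have hbraid : b.τ12 μ * b.τ23 μ * b.τ12 μ = b.τ23 μ * b.τ12 μ * b.τ23 μ := by
      rw [← h12, ← h23, ← map_mul, ← map_mul, ← map_mul, ← map_mul]
      exact congrArg ρ (by decide)
    have hD : ∀ (i j m : C.S) (f : C.Hm i j m), b.doubleDual μ f = f := fun i j m f =>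
      doubleDual_eq_of_braid μ hb hbraid f
    have hinv34 : ∀ x : C.H4, s.𝔽 (b.τ34 μ x) = s.𝔽 x := fun x => by
      rw [← h34, ← hinv (Equiv.swap 2 3) x, Equiv.swap_inv]
    have hroot := s.root_eq_dimL hb hD hinv34
    have hrel : ∀ i, s.relRoot i = 1 := fun i => by
      rw [RootChoice.relRoot, hroot, div_self (dimL_ne_zero μ hb i)]
    refine ⟨fun i => ?_, fun i j m α ε hα => ?_⟩
    -- The right dimension of i is d_ī, and the root does not distinguish i from ī.
    · rw [← dimL_bar, ← hroot, ← hroot, s.root_bar]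
    · obtain ⟨hne, -, h⟩ := hα
      rw [hD, hrel, hrel, hrel, mul_one, mul_one, mul_one] at h
      have h₁ : (ε - 1) • α = 0 := by rw [sub_smul, ← h, one_smul, sub_self]
      exact sub_eq_zero.1 ((smul_eq_zero.1 h₁).resolve_right hne)
  · rintro ⟨hd, hε⟩
    have hD := s.doubleDual_eq_self hb hd hε
    have hroot : ∀ i, s.root i = b.dimL μ i := fun i =>
      s.root_of_eq i (by rw [dimL_bar, hd])
    obtain ⟨ρ, h12, h23, h34⟩ := Veined.exists_permFinFour_hom (τ12_mul_self μ hb)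
      (τ23_mul_self μ hb) (τ34_mul_self μ hb) (τ12_braid μ hb hD) (τ34_braid μ hb hD)
      (τ12_mul_τ34 μ)
    refine ⟨ρ, h12, h23, h34, ?_⟩
    have hs12 : ∀ x : C.H4, s.𝔽 (b.τ12 μ x) = s.𝔽 x := s.𝔽_τ12 hb fun i p l f g => by
      have h := scalar_left_partial_trace μ hb f g
      rwa [hD, ← hd, ← hd, ← hroot, ← hroot] at h
    have hs34 : ∀ x : C.H4, s.𝔽 (b.τ34 μ x) = s.𝔽 x := s.𝔽_τ34 hb fun q r l f g => by
      have h := scalar_right_partial_trace μ hb f g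
      rwa [hD, ← hroot, ← hroot] at h
    have hall : ∀ (g : Equiv.Perm (Fin 4)) (x : C.H4), s.𝔽 (ρ g x) = s.𝔽 x := by
      intro g
      -- Every permutation is a word in the three transpositions, so invariance under the generators
      -- suffices.
      obtain ⟨w, rfl⟩ := Veined.normalWord_swap_bijective.2 g
      exact Veined.normalWord_induction (P := fun g => ∀ x : C.H4, s.𝔽 (ρ g x) = s.𝔽 x)
        (fun x => by rw [map_one, Module.End.one_apply])
        (fun g h hg hh x => by rw [map_mul, Module.End.mul_apply, hg, hh])
        (by rw [h12]; exact hs12) (by rw [h23]; exact s.𝔽_τ23 hb) (by rw [h34]; exact hs34) w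
    exact fun g x => hall g⁻¹ x
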